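/- **Theorem (Decoder Retrieval).** Let $\Sigma$ be a finite alphabet. For a word $w=w_1\cdots w_m\in\Sigma^*$ and a decoder $D\subseteq\Sigma^2$, let $G(D,w)$ be the graph with vertex set $\{1,\dots,m\}$ in which $i<j$ are adjacent if and only if $w_iw_j\in D$. An isomorphism $f$ from a simple graph $G=(V,E)$ to $G(D,w)$ respects a coloring $\chi\colon V\to\Sigma$ if $\chi(v)=w_{f(v)}$ for all $v\in V$. There is a deterministic algorithm which, given a finite simple graph $G=(V,E)$, a finite alphabet $\Sigma$, a coloring $\chi\colon V\to\Sigma$ and a word $w\in\Sigma^{|V|}$, decides whether there is a decoder $D\subseteq\Sigma^2$ such that $G$ is isomorphic to $G(D,w)$ by an isomorphism that respects $\chi$, and outputs such a $D$ if one exists, in time polynomial in $|V|+|\Sigma|$. Here the graph is given by its adjacency matrix, $V$ and $\Sigma$ are given as $\{0,\dots,|V|-1\}$ and $\{0,\dots,|\Sigma|-1\}$, and time is the number of steps of a random access machine whose unit-cost arithmetic operations are addition and truncated subtraction of natural numbers. -/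

import Mathlib

/-! ### Letter graphs -/

/-- The letter graph of a decoder `D ⊆ Σ²` and a word `w`: its vertices are the positions of `w`,
and positions `i < j` are adjacent iff the two-letter word `w_i w_j` belongs to `D`. -/
def letterGraph {α : Type*} (D : Set (α × α)) (w : List α) : SimpleGraph (Fin w.length) where
  Adj i j := (i < j ∧ (w.get i, w.get j) ∈ D) ∨ (j < i ∧ (w.get j, w.get i) ∈ D)
  symm := ⟨fun _ _ h => h.symm⟩
  loopless := ⟨fun _ h => by
    rcases h with h | h <;> exact lt_irrefl _ h.1⟩

/-- `G` is isomorphic to the letter graph of `D` and `w` by an isomorphism that respects the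
coloring `χ`. -/
def IsLetterGraphRespecting {V α : Type*} (G : SimpleGraph V) (χ : V → α) (w : List α)
    (D : Set (α × α)) : Prop :=
  ∃ f : G ≃g letterGraph D w, ∀ v, χ v = w.get (f v)

/-! ### A random access machine with a step count

Programs of a random access machine in structured form. The machine has registers and a memory,
both indexed by `ℕ` and holding natural numbers; its arithmetic is addition and truncated
subtraction only (no multiplication). Every elementary action (an assignment, a store, a test, a
move to the next command) is one step. The expressions are part of the fixed program, so evaluating
one takes a bounded number of operations. In `t` steps numbers grow by `O(t)` bits only, so
polynomial time on this machine is polynomial time on a Turing machine. -/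

namespace RAM

/-- Arithmetic expressions. -/
inductive Expr : Type
  /-- a numeral -/
  | const (c : ℕ)
  /-- the content of register `x` -/
  | reg (x : ℕ)
  /-- the content of the memory cell whose address is the value of `e` -/
  | mem (e : Expr)
  | add (e₁ e₂ : Expr)
  | sub (e₁ e₂ : Expr)

/-- Programs. -/
inductive Program : Type
  | skip
  /-- put the value of `e` into register `x` -/
  | assign (x : ℕ) (e : Expr)
  /-- put the value of `e` into the memory cell whose address is the value of `a` -/
  | store (a e : Expr)
  | seq (P Q : Program)
  /-- run `P` if the value of `e` is not zero, and `Q` otherwise -/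
  | ite (e : Expr) (P Q : Program)
  /-- run `P` again and again while the value of `e` is not zero -/
  | loop (e : Expr) (P : Program)

/-- Contents of the registers and of the memory. -/
structure State : Type where
  reg : ℕ → ℕ
  mem : ℕ → ℕ

def Expr.eval (s : State) : Expr → ℕ
  | .const c => c
  | .reg x => s.reg x
  | .mem e => s.mem (e.eval s)
  | .add e₁ e₂ => e₁.eval s + e₂.eval s
  | .sub e₁ e₂ => e₁.eval s - e₂.eval s

/-- One step of the machine. A configuration consists of the list of the programs that remain to be
executed, in this order, and of the current state. The machine has halted when the list is empty. -/
def step : List Program × State → List Program × State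
  | ([], s) => ([], s)
  | (.skip :: K, s) => (K, s)
  | (.assign x e :: K, s) => (K, { s with reg := Function.update s.reg x (e.eval s) })
  | (.store a e :: K, s) => (K, { s with mem := Function.update s.mem (a.eval s) (e.eval s) })
  | (.seq P Q :: K, s) => (P :: Q :: K, s)
  | (.ite e P Q :: K, s) => (if e.eval s ≠ 0 then P :: K else Q :: K, s)
  | (.loop e P :: K, s) => (if e.eval s ≠ 0 then P :: .loop e P :: K else K, s)

/-- Initially, the input occupies the first memory cells and everything else is zero. -/
def initial (input : List ℕ) : State where
  reg := fun _ => 0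
  mem := fun i => input.getD i 0

/-- Started on `input`, the program `P` halts after at most `t` steps with final memory `m`. -/
def HaltsWithin (P : Program) (input : List ℕ) (t : ℕ) (m : ℕ → ℕ) : Prop :=
  ∃ s : State, step^[t] ([P], initial input) = ([], s) ∧ s.mem = m

end RAM

/-! ### Decoder Retrieval -/

namespace DecoderRetrieval

/-- An instance: a graph on the vertices `0, …, n - 1`, the alphabet `{0, …, k - 1}`, a coloring of
the vertices by letters, and a word with as many letters as there are vertices. -/
structure Input : Type where
  n : ℕ
  k : ℕ
  graph : SimpleGraph (Fin n)
  color : Fin n → Fin k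
  word : List (Fin k)
  length_word : word.length = n

/-- The decoders that solve an instance. -/
def Input.IsSolution (I : Input) (D : Set (Fin I.k × Fin I.k)) : Prop :=
  IsLetterGraphRespecting I.graph I.color I.word D

open Classical in
/-- The input as given to the machine: `n`, `k`, the list of the `n` colors, the `n` letters of the
word, and the `n * n` entries of the adjacency matrix, row by row. -/
noncomputable def Input.encode (I : Input) : List ℕ :=
  [I.n, I.k] ++ List.ofFn (fun v => (I.color v : ℕ)) ++ I.word.map (fun a => (a : ℕ)) ++
    List.ofFn (fun i : Fin (I.n * I.n) => if I.graph.Adj i.divNat i.modNat then 1 else 0)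

/-- The decoder over `{0, …, k - 1}` given by the `k * k` memory cells from address `1` on:
cell `1 + (a * k + b)` holds `1` iff the two-letter word `ab` belongs to the decoder. -/
def readDecoder (k : ℕ) (m : ℕ → ℕ) : Set (Fin k × Fin k) :=
  {p | m (1 + ((p.1 : ℕ) * k + (p.2 : ℕ))) = 1}

/-- The memory `m` holds a correct answer for `I`: cell `0` holds `0` and there is no solution, or
cell `0` holds `1` and the cells after it hold a solution. -/
def Input.CorrectAnswer (I : Input) (m : ℕ → ℕ) : Prop :=
  (m 0 = 0 ∧ ¬ ∃ D, I.IsSolution D) ∨ (m 0 = 1 ∧ I.IsSolution (readDecoder I.k m))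

end DecoderRetrieval

/-! The color degree of a vertex `v` towards `b` is its number of neighbors of color `b`. In a
letter graph, the degree towards `b` of a position with letter `a` depends only on which of the
words `ab`, `ba` lie in the decoder. It is the number of `b`s after the position, the number before
it, a constant on the class of `a`, or zero. Adjacency can be recovered from color degrees
(`degDetermined_LG`), so a bijection preserving colors and color degrees is an isomorphism
(`adj_iff_of_deg_eq`). A candidate decoder is therefore tested by counting vertices and positions
with the same color and degree vector (`sol_iff`); no isomorphism is searched for.

To find a candidate, call `(a, b)` active if both edges and nonedges occur between the two classes.
For pairs that are not active, the graph itself says whether to take both words or neither. For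
active pairs exactly one of `ab`, `ba` is taken. Further necessary conditions (`consistent_LG`) are
that the degree distribution fits the counts in the word, and that two words `ab`, `ad` agree or
differ when degrees towards `b` and `d` vary in the same or in opposite directions. All are
equations or inequations between two truth values.

The main point is that these conditions suffice once a solution exists (`Sol.choice`). Where a
consistent choice differs from a solution on an active pair `ab`, the fitting conditions make the
subword of `a`s and `b`s palindromic, so the new degrees are the old ones read backwards along the
class of `a`. The conditions on directions prevent a class from needing both the identity and the
reversal (`deg_choice_eq_or_reversal`). Hence a permutation acting on each class by one of the two
matches all degrees.

The algorithm solves the equations by merging signed representatives, writes down the resulting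
decoder and tests it. A positive answer is always sound, and if a solution exists the propagated
choice is consistent (`consistent_signChoice`), so the test succeeds. Polynomial time follows from
closure properties of `Comp` and `CompS`, which build a program along with each definition. -/

/-! ### Programs with polynomial running time -/

namespace RAM

/-- Started in state `s`, the program `P` ends in state `s'` after exactly `t` steps. -/
def Runs (P : Program) (s s' : State) (t : ℕ) : Prop :=
  ∀ K, step^[t] (P :: K, s) = (K, s')

theorem Runs.skip (s : State) : Runs .skip s s 1 := fun _ => rfl

theorem Runs.assign (x : ℕ) (e : Expr) (s : State) :
    Runs (.assign x e) s { s with reg := Function.update s.reg x (e.eval s) } 1 := fun _ => rfl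

theorem Runs.store (a e : Expr) (s : State) :
    Runs (.store a e) s { s with mem := Function.update s.mem (a.eval s) (e.eval s) } 1 :=
  fun _ => rfl

theorem Runs.seq {P Q : Program} {s s' s'' : State} {t t' : ℕ} (h : Runs P s s' t)
    (h' : Runs Q s' s'' t') : Runs (.seq P Q) s s'' (t' + (t + 1)) := fun K => by
  rw [Function.iterate_add_apply, Function.iterate_add_apply _ t 1]
  change step^[t'] (step^[t] (P :: Q :: K, s)) = _
  rw [h, h']

theorem Runs.ite_pos {e : Expr} {P Q : Program} {s s' : State} {t : ℕ} (he : e.eval s ≠ 0)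
    (h : Runs P s s' t) : Runs (.ite e P Q) s s' (t + 1) := fun K => by
  rw [Function.iterate_add_apply]
  simpa [step, he] using h K

theorem Runs.ite_neg {e : Expr} {P Q : Program} {s s' : State} {t : ℕ} (he : e.eval s = 0)
    (h : Runs Q s s' t) : Runs (.ite e P Q) s s' (t + 1) := fun K => by
  rw [Function.iterate_add_apply]
  simpa [step, he] using h K

theorem Runs.loop_zero {e : Expr} {P : Program} {s : State} (he : e.eval s = 0) :
    Runs (.loop e P) s s 1 := fun K => by simp [step, he]

theorem Runs.loop_step {e : Expr} {P : Program} {s s' s'' : State} {t t' : ℕ}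
    (he : e.eval s ≠ 0) (h : Runs P s s' t) (h' : Runs (.loop e P) s' s'' t') :
    Runs (.loop e P) s s'' (t' + (t + 1)) := fun K => by
  rw [Function.iterate_add_apply, Function.iterate_add_apply _ t 1]
  have : step^[1] (.loop e P :: K, s) = (P :: .loop e P :: K, s) := by simp [step, he]
  rw [this, h, h']

/-- A loop with a counted number of rounds, each of which takes at most `T` steps. -/
theorem Runs.loop_count {e : Expr} {P : Program} {T n : ℕ} (J : ℕ → State → Prop)
    (hbody : ∀ i < n, ∀ s, J i s → e.eval s ≠ 0 ∧ ∃ t s', t ≤ T ∧ Runs P s s' t ∧ J (i + 1) s')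
    (hend : ∀ s, J n s → e.eval s = 0) {s : State} (h0 : J 0 s) :
    ∃ t s', t ≤ n * (T + 1) + 1 ∧ Runs (.loop e P) s s' t ∧ J n s' := by
  -- Induction on the number `k` of rounds still to come, with the current state arbitrary.
  suffices H : ∀ k i, i + k = n → ∀ s, J i s →
      ∃ t s', t ≤ k * (T + 1) + 1 ∧ Runs (.loop e P) s s' t ∧ J n s' from H n 0 (by simp) s h0
  intro k
  induction k with
  | zero =>
    rintro i rfl s hs
    exact ⟨1, s, by simp, .loop_zero (hend s hs), hs⟩
  | succ k ih =>
    intro i hi s hs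
    obtain ⟨he, t, s', ht, hr, hs'⟩ := hbody i (by omega) s hs
    obtain ⟨t', s'', ht', hr', hs''⟩ := ih (i + 1) (by omega) s' hs'
    exact ⟨_, s'', by rw [Nat.succ_mul]; omega, hr.loop_step he hr', hs''⟩

/-! ### Functions and memory transformations computable in polynomial time -/

/-- Contexts: two parameters `n` and `k`, and a stack of local variables. -/
structure Env : Type where
  n : ℕ
  k : ℕ
  var : ℕ → ℕ

namespace Env

/-- Put a new local variable on the stack. -/
def push (c : Env) (i : ℕ) : Env := ⟨c.n, c.k, fun j => Nat.casesOn j i c.var⟩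

/-- Remove the last local variable from the stack. -/
def pop (c : Env) : Env := ⟨c.n, c.k, fun j => c.var (j + 1)⟩

/-- The last local variable. -/
def top (c : Env) : ℕ := c.var 0

def size (c : Env) : ℕ := c.n + c.k

/-- The contents of the registers of `s` form the context `c`, whose parameters and local variables
are kept in the registers `a`, `b` and `l j`. -/
structure Holds (a b : ℕ) (l : ℕ → ℕ) (c : Env) (r : ℕ → ℕ) : Prop where
  n : r a = c.n
  k : r b = c.k
  var : ∀ j, r (l j) = c.var j

end Env

/-- `P` takes states that hold the context to states with the register contents below `d` unchanged
and the memory changed by `F`, and the value of `f` in register `d`, in polynomial time. -/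
structure Solves (p : Polynomial ℕ) (a b : ℕ) (l : ℕ → ℕ) (d : ℕ) (P : Program)
    (Post : Env → State → State → Prop) : Prop where
  run : ∀ c s, Env.Holds a b l c s.reg → ∃ t s', t ≤ p.eval c.size ∧ Runs P s s' t ∧
    (∀ i < d, s'.reg i = s.reg i) ∧ Post c s s'

/-- The function `f` of the context and the memory is computed in polynomial time. -/
def Comp (f : Env → (ℕ → ℕ) → ℕ) : Prop :=
  ∃ p : Polynomial ℕ, ∀ a b l d, a < d → b < d → (∀ j, l j < d) → ∃ P, Solves p a b l d P
    fun c s s' => s'.mem = s.mem ∧ s'.reg d = f c s.mem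

/-- The transformation `F` of the memory, depending on the context, is performed in polynomial
time. -/
def CompS (F : Env → (ℕ → ℕ) → ℕ → ℕ) : Prop :=
  ∃ p : Polynomial ℕ, ∀ a b l d, a < d → b < d → (∀ j, l j < d) → ∃ P, Solves p a b l d P
    fun c s s' => s'.mem = F c s.mem

/-- Frame property: the context lives below `d` and programs use only registers from `d` on as
scratch space, so the context survives their execution. -/
theorem Env.Holds.congr {a b : ℕ} {l : ℕ → ℕ} {d : ℕ} {c : Env} {r r' : ℕ → ℕ}
    (h : Holds a b l c r) (ha : a < d) (hb : b < d) (hl : ∀ j, l j < d)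
    (hr : ∀ i < d, r' i = r i) : Holds a b l c r' :=
  ⟨by rw [hr _ ha, h.n], by rw [hr _ hb, h.k], fun j => by rw [hr _ (hl j), h.var]⟩

theorem Env.Holds.push {a b : ℕ} {l : ℕ → ℕ} {c : Env} {r : ℕ → ℕ}
    (h : Holds a b l c r) (x : ℕ) : Holds a b (fun j => Nat.casesOn j x l) (c.push (r x)) r :=
  ⟨h.n, h.k, fun j => by cases j <;> simp [Env.push, h.var]⟩

theorem Env.Holds.pop {a b : ℕ} {l : ℕ → ℕ} {c : Env} {r : ℕ → ℕ}
    (h : Holds a b l c r) : Holds a b (fun j => l (j + 1)) c.pop r :=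
  ⟨h.n, h.k, fun _ => h.var _⟩

/-- A function that is the value of a machine expression. -/
theorem Comp.of_expr {f : Env → (ℕ → ℕ) → ℕ} (e : ℕ → ℕ → (ℕ → ℕ) → Expr)
    (h : ∀ a b l c s, Env.Holds a b l c s.reg → (e a b l).eval s = f c s.mem) : Comp f :=
  ⟨1, fun a b l d _ _ _ => ⟨.assign d (e a b l), ⟨fun c s hc => ⟨1, _, by simp, .assign _ _ _,
    fun i hi => by simp [hi.ne], rfl, by simp [h a b l c s hc]⟩⟩⟩⟩

theorem Comp.const (x : ℕ) : Comp fun _ _ => x :=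
  .of_expr (fun _ _ _ => .const x) fun _ _ _ _ _ _ => rfl

theorem Comp.n : Comp fun c _ => c.n :=
  .of_expr (fun a _ _ => .reg a) fun _ _ _ _ _ h => h.n

theorem Comp.k : Comp fun c _ => c.k :=
  .of_expr (fun _ b _ => .reg b) fun _ _ _ _ _ h => h.k

theorem Comp.top : Comp fun c _ => c.top :=
  .of_expr (fun _ _ l => .reg (l 0)) fun _ _ _ _ _ h => h.var 0

theorem Comp.pop {f : Env → (ℕ → ℕ) → ℕ} (h : Comp f) : Comp fun c m => f c.pop m := by
  obtain ⟨p, hp⟩ := h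
  refine ⟨p, fun a b l d ha hb hl => ?_⟩
  obtain ⟨P, hP⟩ := hp a b (fun j => l (j + 1)) d ha hb fun _ => hl _
  exact ⟨P, ⟨fun c s hc => hP.run c.pop s hc.pop⟩⟩

/-- Composition of a function with an operation of the machine. -/
theorem Comp.map₂ {f g : Env → (ℕ → ℕ) → ℕ} (hf : Comp f) (hg : Comp g)
    (o : (ℕ → ℕ) → ℕ → ℕ → ℕ) (e : ℕ → ℕ → Expr)
    (he : ∀ x y s, (e x y).eval s = o s.mem (s.reg x) (s.reg y)) :
    Comp fun c m => o m (f c m) (g c m) := by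
  obtain ⟨p, hp⟩ := hf
  obtain ⟨q, hq⟩ := hg
  refine ⟨p + q + 3, fun a b l d ha hb hl => ?_⟩
  obtain ⟨P, hP⟩ := hp a b l d ha hb hl
  -- The second program gets scratch space from `d + 1` on, so the value of `f` in register `d` is
  -- preserved.
  obtain ⟨Q, hQ⟩ := hq a b l (d + 1) (by omega) (by omega) fun j => (hl j).trans (by omega)
  refine ⟨.seq P (.seq Q (.assign d (e d (d + 1)))), ⟨fun c s hc => ?_⟩⟩
  obtain ⟨t, s₁, ht, hr, hd, hm, hv⟩ := hP.run c s hc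
  obtain ⟨t', s₂, ht', hr', hd', hm', hv'⟩ := hQ.run c s₁ (hc.congr ha hb hl hd)
  refine ⟨_, _, ?_, hr.seq (hr'.seq (.assign _ _ _)), fun i hi => ?_, ?_, ?_⟩
  · simp only [Polynomial.eval_add, Polynomial.eval_ofNat]
    omega
  · simp [hi.ne, hd' i (by omega), hd i hi]
  · simp [hm, hm']
  · simp [he, hv', hm', hm, hd' d (by omega), hv]

theorem Comp.add {f g : Env → (ℕ → ℕ) → ℕ} (hf : Comp f) (hg : Comp g) :
    Comp fun c m => f c m + g c m :=
  hf.map₂ hg (fun _ x y => x + y) (fun x y => .add (.reg x) (.reg y)) fun _ _ _ => rfl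

theorem Comp.sub {f g : Env → (ℕ → ℕ) → ℕ} (hf : Comp f) (hg : Comp g) :
    Comp fun c m => f c m - g c m :=
  hf.map₂ hg (fun _ x y => x - y) (fun x y => .sub (.reg x) (.reg y)) fun _ _ _ => rfl

theorem Comp.mem {f : Env → (ℕ → ℕ) → ℕ} (hf : Comp f) : Comp fun c m => m (f c m) :=
  hf.map₂ hf (fun m x _ => m x) (fun x _ => .mem (.reg x)) fun _ _ _ => rfl

/-- The bound `q` on the number of summands is what keeps the running time polynomial. Registers:
`d` holds the number of rounds, `d + 1` the partial sum, `d + 2` the summation index (the new local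
variable), `d + 3` the current summand. -/
theorem Comp.sum {f g : Env → (ℕ → ℕ) → ℕ} (q : Polynomial ℕ)
    (hq : ∀ c m, f c m ≤ q.eval c.size) (hf : Comp f) (hg : Comp g) :
    Comp fun c m => ∑ i ∈ Finset.range (f c m), g (c.push i) m := by
  obtain ⟨p, hp⟩ := hf
  obtain ⟨p', hp'⟩ := hg
  refine ⟨p + q * (p' + 5) + 20, fun a b l d ha hb hl => ?_⟩
  obtain ⟨P, hP⟩ := hp a b l d ha hb hl
  obtain ⟨Q, hQ⟩ := hp' a b (fun j => Nat.casesOn j (d + 2) l) (d + 3) (by omega) (by omega) fun j =>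
    by cases j with
      | zero => simp
      | succ j => exact (hl j).trans (by omega)
  refine ⟨.seq P (.seq (.assign (d + 1) (.const 0)) (.seq (.assign (d + 2) (.const 0)) (.seq
    (.loop (.sub (.reg d) (.reg (d + 2))) (.seq Q (.seq
      (.assign (d + 1) (.add (.reg (d + 1)) (.reg (d + 3))))
      (.assign (d + 2) (.add (.reg (d + 2)) (.const 1))))))
    (.assign d (.reg (d + 1)))))), ⟨fun c s hc => ?_⟩⟩
  obtain ⟨t, s₁, ht, hr, hd, hm, hv⟩ := hP.run c s hc
  set N := f c s.mem with hN
  let J : ℕ → State → Prop := fun i z => z.mem = s.mem ∧ (∀ j < d, z.reg j = s.reg j) ∧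
    z.reg d = N ∧ z.reg (d + 1) = ∑ j ∈ Finset.range i, g (c.push j) s.mem ∧ z.reg (d + 2) = i
  have key := Runs.loop_count (e := .sub (.reg d) (.reg (d + 2))) (P := .seq Q (.seq
      (.assign (d + 1) (.add (.reg (d + 1)) (.reg (d + 3))))
      (.assign (d + 2) (.add (.reg (d + 2)) (.const 1))))) (T := p'.eval c.size + 4) (n := N) J
      (by
        rintro i hi z ⟨zm, zr, zd, z1, z2⟩
        refine ⟨by simp only [Expr.eval, zd, z2]; omega, ?_⟩
        have hz : Env.Holds a b (fun j => Nat.casesOn j (d + 2) l) (c.push i) z.reg := by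
          have := (hc.congr ha hb hl zr).push (d + 2)
          rwa [z2] at this
        obtain ⟨t', z', ht', hr', hd', hm', hv'⟩ := hQ.run _ z hz
        refine ⟨_, _, ?_, hr'.seq ((Runs.assign _ _ _).seq (.assign _ _ _)), ?_, ?_, ?_, ?_, ?_⟩
        · have : (c.push i).size = c.size := rfl
          rw [this] at ht'
          omega
        · simp [hm', zm]
        · intro j hj
          simp [show j ≠ d + 1 by omega, show j ≠ d + 2 by omega, hd' j (by omega), zr j hj]
        · simp [hd' d (by omega), zd]
        · simp [hd' (d + 1) (by omega), z1, hv', zm, Finset.sum_range_succ, Expr.eval]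
        · simp [hd' (d + 2) (by omega), z2, Expr.eval])
      (by
        rintro z ⟨-, -, zd, -, z2⟩
        simp [Expr.eval, zd, z2])
      (s := ⟨Function.update (Function.update s₁.reg (d + 1) 0) (d + 2) 0, s₁.mem⟩)
      (by
        refine ⟨hm, ?_, ?_, ?_, ?_⟩
        · intro j hj
          simp [show j ≠ d + 1 by omega, show j ≠ d + 2 by omega, hd j hj]
        · simp [hv]
        · simp
        · simp)
  obtain ⟨t', z, ht', hr', zm, zr, zd, z1, z2⟩ := key
  refine ⟨_, _, ?_, hr.seq ((Runs.assign _ _ _).seq ((Runs.assign _ _ _).seq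
    (hr'.seq (.assign _ _ _)))), ?_, ?_, ?_⟩
  · have h1 := hq c s.mem
    have h2 : N * (p'.eval c.size + 4 + 1) ≤ q.eval c.size * (p'.eval c.size + 5) :=
      Nat.mul_le_mul h1 le_rfl
    simp only [Polynomial.eval_add, Polynomial.eval_mul, Polynomial.eval_ofNat]
    omega
  · intro i hi
    simp [hi.ne, zr i hi]
  · simp [zm]
  · simp [Expr.eval, z1, hN]

theorem CompS.skip : CompS fun _ m => m :=
  ⟨1, fun _ _ _ _ _ _ _ => ⟨.skip, ⟨fun _ s _ => ⟨1, s, by simp, .skip s, fun _ _ => rfl, rfl⟩⟩⟩⟩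

theorem CompS.store {f g : Env → (ℕ → ℕ) → ℕ} (hf : Comp f) (hg : Comp g) :
    CompS fun c m => Function.update m (f c m) (g c m) := by
  obtain ⟨p, hp⟩ := hf
  obtain ⟨q, hq⟩ := hg
  refine ⟨p + q + 3, fun a b l d ha hb hl => ?_⟩
  obtain ⟨P, hP⟩ := hp a b l d ha hb hl
  obtain ⟨Q, hQ⟩ := hq a b l (d + 1) (by omega) (by omega) fun j => (hl j).trans (by omega)
  refine ⟨.seq P (.seq Q (.store (.reg d) (.reg (d + 1)))), ⟨fun c s hc => ?_⟩⟩
  obtain ⟨t, s₁, ht, hr, hd, hm, hv⟩ := hP.run c s hc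
  obtain ⟨t', s₂, ht', hr', hd', hm', hv'⟩ := hQ.run c s₁ (hc.congr ha hb hl hd)
  refine ⟨_, _, ?_, hr.seq (hr'.seq (.store _ _ _)), fun i hi => ?_, ?_⟩
  · simp only [Polynomial.eval_add, Polynomial.eval_ofNat]
    omega
  · simp [hd' i (by omega), hd i hi]
  · simp [Expr.eval, hv', hm', hm, hd' d (by omega), hv]

theorem CompS.seq {F G : Env → (ℕ → ℕ) → ℕ → ℕ} (hF : CompS F) (hG : CompS G) :
    CompS fun c m => G c (F c m) := by
  obtain ⟨p, hp⟩ := hF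
  obtain ⟨q, hq⟩ := hG
  refine ⟨p + q + 1, fun a b l d ha hb hl => ?_⟩
  obtain ⟨P, hP⟩ := hp a b l d ha hb hl
  obtain ⟨Q, hQ⟩ := hq a b l d ha hb hl
  refine ⟨.seq P Q, ⟨fun c s hc => ?_⟩⟩
  obtain ⟨t, s₁, ht, hr, hd, hm⟩ := hP.run c s hc
  obtain ⟨t', s₂, ht', hr', hd', hm'⟩ := hQ.run c s₁ (hc.congr ha hb hl hd)
  refine ⟨_, _, ?_, hr.seq hr', fun i hi => by rw [hd' i hi, hd i hi], by rw [hm', hm]⟩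
  simp only [Polynomial.eval_add, Polynomial.eval_one]
  omega

/-- Run a program with the value of `f` as a new local variable. -/
theorem CompS.bind {f : Env → (ℕ → ℕ) → ℕ} {F : Env → (ℕ → ℕ) → ℕ → ℕ} (hf : Comp f)
    (hF : CompS F) : CompS fun c m => F (c.push (f c m)) m := by
  obtain ⟨p, hp⟩ := hf
  obtain ⟨q, hq⟩ := hF
  refine ⟨p + q + 1, fun a b l d ha hb hl => ?_⟩
  obtain ⟨P, hP⟩ := hp a b l d ha hb hl
  obtain ⟨Q, hQ⟩ := hq a b (fun j => Nat.casesOn j d l) (d + 1) (by omega) (by omega) fun j =>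
    by cases j with
      | zero => simp
      | succ j => exact (hl j).trans (by omega)
  refine ⟨.seq P Q, ⟨fun c s hc => ?_⟩⟩
  obtain ⟨t, s₁, ht, hr, hd, hm, hv⟩ := hP.run c s hc
  have hc₁ := (hc.congr ha hb hl hd).push d
  obtain ⟨t', s₂, ht', hr', hd', hm'⟩ := hQ.run _ s₁ hc₁
  refine ⟨_, _, ?_, hr.seq hr', fun i hi => by rw [hd' i (by omega), hd i hi],
    by rw [hm', hm, hv]⟩
  simp only [Polynomial.eval_add, Polynomial.eval_one]
  change t' ≤ q.eval c.size at ht'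
  omega

/-- Perform `F 0`, …, `F (n - 1)` one after the other. -/
def iter {M : Type*} (F : ℕ → M → M) : ℕ → M → M
  | 0, m => m
  | n + 1, m => F n (iter F n m)

theorem CompS.loop {f : Env → (ℕ → ℕ) → ℕ} {F : Env → (ℕ → ℕ) → ℕ → ℕ} (q : Polynomial ℕ)
    (hq : ∀ c m, f c m ≤ q.eval c.size) (hf : Comp f) (hF : CompS F) :
    CompS fun c m => iter (fun i => F (c.push i)) (f c m) m := by
  obtain ⟨p, hp⟩ := hf
  obtain ⟨p', hp'⟩ := hF
  refine ⟨p + q * (p' + 3) + 20, fun a b l d ha hb hl => ?_⟩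
  obtain ⟨P, hP⟩ := hp a b l d ha hb hl
  obtain ⟨Q, hQ⟩ := hp' a b (fun j => Nat.casesOn j (d + 1) l) (d + 2) (by omega) (by omega) fun j =>
    by cases j with
      | zero => simp
      | succ j => exact (hl j).trans (by omega)
  refine ⟨.seq P (.seq (.assign (d + 1) (.const 0))
    (.loop (.sub (.reg d) (.reg (d + 1))) (.seq Q
      (.assign (d + 1) (.add (.reg (d + 1)) (.const 1)))))), ⟨fun c s hc => ?_⟩⟩
  obtain ⟨t, s₁, ht, hr, hd, hm, hv⟩ := hP.run c s hc
  set N := f c s.mem with hN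
  let J : ℕ → State → Prop := fun i z => z.mem = iter (fun i => F (c.push i)) i s.mem ∧
    (∀ j < d, z.reg j = s.reg j) ∧ z.reg d = N ∧ z.reg (d + 1) = i
  have key := Runs.loop_count (e := .sub (.reg d) (.reg (d + 1))) (P := .seq Q
      (.assign (d + 1) (.add (.reg (d + 1)) (.const 1)))) (T := p'.eval c.size + 2) (n := N) J
      (by
        rintro i hi z ⟨zm, zr, zd, z2⟩
        refine ⟨by simp only [Expr.eval, zd, z2]; omega, ?_⟩
        have hz : Env.Holds a b (fun j => Nat.casesOn j (d + 1) l) (c.push i) z.reg := by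
          have := (hc.congr ha hb hl zr).push (d + 1)
          rwa [z2] at this
        obtain ⟨t', z', ht', hr', hd', hm'⟩ := hQ.run _ z hz
        refine ⟨_, _, ?_, hr'.seq (.assign _ _ _), ?_, ?_, ?_, ?_⟩
        · have : (c.push i).size = c.size := rfl
          rw [this] at ht'
          omega
        · simp [hm', zm, iter]
        · intro j hj
          simp [show j ≠ d + 1 by omega, hd' j (by omega), zr j hj]
        · simp [hd' d (by omega), zd]
        · simp [hd' (d + 1) (by omega), z2, Expr.eval])
      (by
        rintro z ⟨-, -, zd, z2⟩
        simp [Expr.eval, zd, z2])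
      (s := ⟨Function.update s₁.reg (d + 1) 0, s₁.mem⟩)
      (by
        refine ⟨by simp [hm, iter], ?_, ?_, ?_⟩
        · intro j hj
          simp [show j ≠ d + 1 by omega, hd j hj]
        · simp [hv]
        · simp)
  obtain ⟨t', z, ht', hr', zm, zr, zd, z2⟩ := key
  refine ⟨_, _, ?_, hr.seq ((Runs.assign _ _ _).seq hr'), ?_, ?_⟩
  · have h1 := hq c s.mem
    have h2 : N * (p'.eval c.size + 2 + 1) ≤ q.eval c.size * (p'.eval c.size + 3) :=
      Nat.mul_le_mul h1 le_rfl
    simp only [Polynomial.eval_add, Polynomial.eval_mul, Polynomial.eval_ofNat]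
    omega
  · exact zr
  · simp [zm, hN]

/-! ### Decidable predicates -/

open Classical in
/-- The number `1` if `p` holds, and `0` otherwise. -/
noncomputable def ind (p : Prop) : ℕ := if p then 1 else 0

theorem ind_pos {p : Prop} (h : p) : ind p = 1 := by simp [ind, h]

theorem ind_neg {p : Prop} (h : ¬ p) : ind p = 0 := by simp [ind, h]

/-- The predicate `p` on the context and the memory is decided in polynomial time. -/
def CompP (p : Env → (ℕ → ℕ) → Prop) : Prop := Comp fun c m => ind (p c m)

theorem Comp.of_eq {f g : Env → (ℕ → ℕ) → ℕ} (hf : Comp f) (h : ∀ c m, g c m = f c m) :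
    Comp g := by
  rwa [show g = f from funext fun c => funext fun m => h c m]

theorem CompP.of_iff {p q : Env → (ℕ → ℕ) → Prop} (hp : CompP p) (h : ∀ c m, q c m ↔ p c m) :
    CompP q := by
  rwa [show q = p from funext fun c => funext fun m => propext (h c m)]

/-- For natural numbers `y - (y - 1)` is the sign of `y`; here `y` is the truncated difference. -/
theorem CompP.lt {f g : Env → (ℕ → ℕ) → ℕ} (hf : Comp f) (hg : Comp g) :
    CompP fun c m => f c m < g c m :=
  ((hg.sub hf).sub ((hg.sub hf).sub (.const 1))).of_eq fun c m => by
    by_cases h : f c m < g c m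
    · rw [ind_pos h]; omega
    · rw [ind_neg h]; omega

theorem CompP.not {p : Env → (ℕ → ℕ) → Prop} (h : CompP p) : CompP fun c m => ¬ p c m :=
  ((Comp.const 1).sub h).of_eq fun c m => by
    by_cases h : p c m <;> simp [ind, h]

theorem CompP.and {p q : Env → (ℕ → ℕ) → Prop} (hp : CompP p) (hq : CompP q) :
    CompP fun c m => p c m ∧ q c m :=
  ((Comp.add hp hq).sub (.const 1)).of_eq fun c m => by
    by_cases h : p c m <;> by_cases h' : q c m <;> simp [ind, h, h']

theorem CompP.or {p q : Env → (ℕ → ℕ) → Prop} (hp : CompP p) (hq : CompP q) :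
    CompP fun c m => p c m ∨ q c m :=
  (hp.not.and hq.not).not.of_iff fun c m => by tauto

theorem CompP.imp {p q : Env → (ℕ → ℕ) → Prop} (hp : CompP p) (hq : CompP q) :
    CompP fun c m => p c m → q c m :=
  (hp.not.or hq).of_iff fun c m => by tauto

theorem CompP.iff {p q : Env → (ℕ → ℕ) → Prop} (hp : CompP p) (hq : CompP q) :
    CompP fun c m => (p c m ↔ q c m) :=
  ((hp.imp hq).and (hq.imp hp)).of_iff fun c m => by tauto

theorem CompP.le {f g : Env → (ℕ → ℕ) → ℕ} (hf : Comp f) (hg : Comp g) :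
    CompP fun c m => f c m ≤ g c m :=
  (CompP.lt hg hf).not.of_iff fun c m => by omega

theorem CompP.eq {f g : Env → (ℕ → ℕ) → ℕ} (hf : Comp f) (hg : Comp g) :
    CompP fun c m => f c m = g c m :=
  ((CompP.le hf hg).and (CompP.le hg hf)).of_iff fun c m => by omega

/-- The number of `i < n` with the property `p`. -/
noncomputable def count (n : ℕ) (p : ℕ → Prop) : ℕ := ∑ i ∈ Finset.range n, ind (p i)

theorem count_pos {n : ℕ} {p : ℕ → Prop} : 0 < count n p ↔ ∃ i < n, p i := by
  simp [count, Nat.pos_iff_ne_zero, ind]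

theorem Comp.count {f : Env → (ℕ → ℕ) → ℕ} {p : Env → (ℕ → ℕ) → Prop} (q : Polynomial ℕ)
    (hq : ∀ c m, f c m ≤ q.eval c.size) (hf : Comp f) (hp : CompP p) :
    Comp fun c m => count (f c m) fun i => p (c.push i) m :=
  Comp.sum q hq hf hp

theorem CompP.ex {f : Env → (ℕ → ℕ) → ℕ} {p : Env → (ℕ → ℕ) → Prop} (q : Polynomial ℕ)
    (hq : ∀ c m, f c m ≤ q.eval c.size) (hf : Comp f) (hp : CompP p) :
    CompP fun c m => ∃ i < f c m, p (c.push i) m :=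
  (CompP.lt (.const 0) (.count q hq hf hp)).of_iff fun _ _ => count_pos.symm

theorem CompP.all {f : Env → (ℕ → ℕ) → ℕ} {p : Env → (ℕ → ℕ) → Prop} (q : Polynomial ℕ)
    (hq : ∀ c m, f c m ≤ q.eval c.size) (hf : Comp f) (hp : CompP p) :
    CompP fun c m => ∀ i < f c m, p (c.push i) m :=
  (CompP.ex q hq hf hp.not).not.of_iff fun _ _ => by push Not; rfl

/-- The machine cannot multiply, so the product is a repeated sum; this is why one factor needs a
polynomial bound. -/
theorem Comp.mul {f g : Env → (ℕ → ℕ) → ℕ} (q : Polynomial ℕ)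
    (hq : ∀ c m, f c m ≤ q.eval c.size) (hf : Comp f) (hg : Comp g) :
    Comp fun c m => f c m * g c m :=
  (Comp.sum q hq hf hg.pop).of_eq fun c m => by
    change _ = ∑ _i ∈ Finset.range (f c m), g c m
    simp

open Classical in
theorem CompS.ite {r : Env → (ℕ → ℕ) → Prop} {F G : Env → (ℕ → ℕ) → ℕ → ℕ} (hr : CompP r)
    (hF : CompS F) (hG : CompS G) : CompS fun c m => if r c m then F c m else G c m := by
  obtain ⟨p₀, hp₀⟩ := hr
  obtain ⟨p, hp⟩ := hF
  obtain ⟨q, hq⟩ := hG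
  refine ⟨p₀ + p + q + 2, fun a b l d ha hb hl => ?_⟩
  obtain ⟨P₀, hP₀⟩ := hp₀ a b l d ha hb hl
  obtain ⟨P, hP⟩ := hp a b l d ha hb hl
  obtain ⟨Q, hQ⟩ := hq a b l d ha hb hl
  refine ⟨.seq P₀ (.ite (.reg d) P Q), ⟨fun c s hc => ?_⟩⟩
  obtain ⟨t, s₁, ht, hr, hd, hm, hv⟩ := hP₀.run c s hc
  have hc₁ := hc.congr ha hb hl hd
  by_cases h : r c s.mem
  · obtain ⟨t', s₂, ht', hr', hd', hm'⟩ := hP.run c s₁ hc₁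
    refine ⟨_, _, ?_, hr.seq (hr'.ite_pos (by simp [Expr.eval, hv, ind, h])),
      fun i hi => by rw [hd' i hi, hd i hi], by simp [h, hm', hm]⟩
    simp only [Polynomial.eval_add, Polynomial.eval_ofNat]
    omega
  · obtain ⟨t', s₂, ht', hr', hd', hm'⟩ := hQ.run c s₁ hc₁
    refine ⟨_, _, ?_, hr.seq (hr'.ite_neg (by simp [Expr.eval, hv, ind, h])),
      fun i hi => by rw [hd' i hi, hd i hi], by simp [h, hm', hm]⟩
    simp only [Polynomial.eval_add, Polynomial.eval_ofNat]
    omega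

/-- A polynomial-time transformation of the memory is performed by a program that finds the
parameters in the first two memory cells. -/
theorem CompS.haltsWithin {F : Env → (ℕ → ℕ) → ℕ → ℕ} (hF : CompS F) :
    ∃ (P : Program) (p : Polynomial ℕ), ∀ input : List ℕ, ∃ t,
      t ≤ p.eval (input.getD 0 0 + input.getD 1 0) ∧
      HaltsWithin P input t (F ⟨input.getD 0 0, input.getD 1 0, fun _ => 0⟩
        fun i => input.getD i 0) := by
  obtain ⟨p, hp⟩ := hF
  -- At the outermost level the stack is empty: all its entries share register `2`, which stays
  -- zero.
  obtain ⟨P, hP⟩ := hp 0 1 (fun _ => 2) 3 (by omega) (by omega) fun _ => by omega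
  refine ⟨.seq (.assign 0 (.mem (.const 0))) (.seq (.assign 1 (.mem (.const 1))) P), p + 4,
    fun input => ?_⟩
  obtain ⟨t, s, ht, hr, -, hm⟩ := hP.run ⟨input.getD 0 0, input.getD 1 0, fun _ => 0⟩
    ⟨Function.update (Function.update (fun _ => 0) 0 (input.getD 0 0)) 1 (input.getD 1 0),
      fun i => input.getD i 0⟩ ⟨by simp, by simp, fun j => by simp⟩
  refine ⟨_, ?_, s, ((Runs.assign 0 _ (initial input)).seq ((Runs.assign 1 _ _).seq hr)) [], hm⟩
  simp only [Polynomial.eval_add, Polynomial.eval_ofNat]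
  change t ≤ p.eval (input.getD 0 0 + input.getD 1 0) at ht
  omega

end RAM

/-! ### Color degrees in letter graphs -/

namespace DecoderRetrieval

variable {V P A : Type*}

/-- The number of neighbors of `v` of color `b`. -/
noncomputable def deg (G : V → V → Prop) (col : V → A) (v : V) (b : A) : ℕ :=
  {u | G v u ∧ col u = b}.ncard

/-- Adjacency in the letter graph of the decoder `D` and the word `W`. -/
def LG [LT P] (D : A → A → Prop) (W : P → A) (p q : P) : Prop :=
  (p < q ∧ D (W p) (W q)) ∨ (q < p ∧ D (W q) (W p))

/-- There is a color-respecting isomorphism from `G` to the letter graph of `D` and `W`. -/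
def Sol [LT P] (G : V → V → Prop) (col : V → A) (W : P → A) (D : A → A → Prop) : Prop :=
  ∃ f : V ≃ P, (∀ v, col v = W (f v)) ∧ ∀ u v, G u v ↔ LG D W (f u) (f v)

/-- Adjacency is determined by the color degrees, as in letter graphs. -/
def DegDetermined (G : V → V → Prop) (col : V → A) : Prop :=
  ∀ u v, u ≠ v → (G u v ↔
    {r | col r = col v ∧ deg G col v (col u) < deg G col r (col u)}.ncard < deg G col u (col v))

def edge (G : V → V → Prop) (col : V → A) (a b : A) : Prop :=
  ∃ u v, col u = a ∧ col v = b ∧ G u v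

def nonedge (G : V → V → Prop) (col : V → A) (a b : A) : Prop :=
  ∃ u v, u ≠ v ∧ col u = a ∧ col v = b ∧ ¬ G u v

/-- Between the color classes `a` and `b` there are edges and nonedges. -/
def active (G : V → V → Prop) (col : V → A) (a b : A) : Prop :=
  edge G col a b ∧ nonedge G col a b

/-- The number of letters `b` after position `p`. -/
noncomputable def aft [LT P] (W : P → A) (p : P) (b : A) : ℕ := {q | p < q ∧ W q = b}.ncard

/-- The number of letters `b` before position `p`. -/
noncomputable def bef [LT P] (W : P → A) (p : P) (b : A) : ℕ := {q | q < p ∧ W q = b}.ncard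

/-- The numbers of neighbors of color `b` of the vertices of color `a` have the same distribution
as the values of `h` at the positions with letter `a`. -/
def Fits (G : V → V → Prop) (col : V → A) (W : P → A) (h : P → A → ℕ) (a b : A) : Prop :=
  ∀ d, {v | col v = a ∧ d ≤ deg G col v b}.ncard = {p | W p = a ∧ d ≤ h p b}.ncard

def Parallel (G : V → V → Prop) (col : V → A) (a b d : A) : Prop :=
  ∃ v v', col v = a ∧ col v' = a ∧ deg G col v b < deg G col v' b ∧
    deg G col v d < deg G col v' d

def Opposite (G : V → V → Prop) (col : V → A) (a b d : A) : Prop :=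
  ∃ v v', col v = a ∧ col v' = a ∧ deg G col v b < deg G col v' b ∧
    deg G col v' d < deg G col v d

/-- The words `ab` and `cd` are required to be both in the decoder or both not. The words `aa`
stand for the value true. -/
def MustAgree [LT P] (G : V → V → Prop) (col : V → A) (W : P → A) (a b c d : A) : Prop :=
  (a = b ∧ c = d) ∨ (active G col a b ∧ ¬ Fits G col W (bef W) a b ∧ c = a ∧ d = a) ∨
    (a = c ∧ Parallel G col a b d)

/-- Exactly one of the words `ab` and `cd` is required to be in the decoder. -/
def MustDiffer [LT P] (G : V → V → Prop) (col : V → A) (W : P → A) (a b c d : A) : Prop :=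
  (active G col a b ∧ c = b ∧ d = a) ∨
    (active G col a b ∧ ¬ Fits G col W (aft W) a b ∧ c = a ∧ d = a) ∨
    (a = c ∧ Opposite G col a b d)

/-- Every condition relates just two truth values, so consistency is a system of equations modulo 2
that merging can solve. The diagonal plays the role of a constant true. -/
def Consistent [LT P] (G : V → V → Prop) (col : V → A) (W : P → A) (x : A → A → Prop) : Prop :=
  ∀ a b c d, (MustAgree G col W a b c d → (x a b ↔ x c d)) ∧
    (MustDiffer G col W a b c d → (x a b ↔ ¬ x c d))

/-- The decoder given by the choice `x` for the active pairs. -/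
def choiceDecoder (G : V → V → Prop) (col : V → A) (x : A → A → Prop) (a b : A) : Prop :=
  edge G col a b ∧ (¬ nonedge G col a b ∨ x a b)

theorem ncard_setOf_equiv (f : V ≃ P) {p : V → Prop} {q : P → Prop} (h : ∀ v, p v ↔ q (f v)) :
    {v | p v}.ncard = {x | q x}.ncard := by
  rw [← Set.ncard_image_of_injective _ f.injective]
  congr 1
  ext x
  simp only [Set.mem_image, Set.mem_ofPred_eq]
  exact ⟨fun ⟨v, hv, e⟩ => e ▸ (h v).1 hv, fun hx => ⟨f.symm x, (h _).2 (by simpa), by simp⟩⟩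

/-! ### Invariance under color-preserving isomorphisms -/

section Transport

variable {G : V → V → Prop} {col : V → A} {H : P → P → Prop} {W : P → A} {f : V ≃ P}

theorem deg_equiv (hc : ∀ v, col v = W (f v)) (hG : ∀ u v, G u v ↔ H (f u) (f v)) (v : V)
    (b : A) : deg G col v b = deg H W (f v) b :=
  ncard_setOf_equiv f fun u => by rw [hG, hc]

theorem edge_equiv (hc : ∀ v, col v = W (f v)) (hG : ∀ u v, G u v ↔ H (f u) (f v)) :
    edge G col = edge H W := by
  ext a b
  simp only [edge, hc, hG, f.exists_congr_left, Equiv.apply_symm_apply]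

theorem nonedge_equiv (hc : ∀ v, col v = W (f v)) (hG : ∀ u v, G u v ↔ H (f u) (f v)) :
    nonedge G col = nonedge H W := by
  ext a b
  simp only [nonedge, hc, hG, f.exists_congr_left, Equiv.apply_symm_apply, ne_eq,
    EmbeddingLike.apply_eq_iff_eq]

theorem active_equiv (hc : ∀ v, col v = W (f v)) (hG : ∀ u v, G u v ↔ H (f u) (f v)) :
    active G col = active H W := by
  ext a b
  rw [active, active, edge_equiv hc hG, nonedge_equiv hc hG]

/-- Only the graph side is transported; the word `W'` and its counts `h` stay fixed. With the other
transports this allows replacing a solvable instance by the letter graph itself. -/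
theorem fits_equiv {Q : Type*} (W' : Q → A) (h : Q → A → ℕ) (hc : ∀ v, col v = W (f v))
    (hG : ∀ u v, G u v ↔ H (f u) (f v)) : Fits G col W' h = Fits H W W' h := by
  ext a b
  refine forall_congr' fun d => ?_
  rw [ncard_setOf_equiv (q := fun p => W p = a ∧ d ≤ deg H W p b) f fun v => by
    rw [hc, deg_equiv hc hG]]

theorem parallel_equiv (hc : ∀ v, col v = W (f v)) (hG : ∀ u v, G u v ↔ H (f u) (f v)) :
    Parallel G col = Parallel H W := by
  ext a b d
  simp only [Parallel, deg_equiv hc hG, hc, f.exists_congr_left, Equiv.apply_symm_apply]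

theorem opposite_equiv (hc : ∀ v, col v = W (f v)) (hG : ∀ u v, G u v ↔ H (f u) (f v)) :
    Opposite G col = Opposite H W := by
  ext a b d
  simp only [Opposite, deg_equiv hc hG, hc, f.exists_congr_left, Equiv.apply_symm_apply]

theorem consistent_equiv {Q : Type*} [LT Q] (W' : Q → A) (hc : ∀ v, col v = W (f v))
    (hG : ∀ u v, G u v ↔ H (f u) (f v)) : Consistent G col W' = Consistent H W W' := by
  ext x
  simp only [Consistent, MustAgree, MustDiffer, active_equiv hc hG, fits_equiv W' _ hc hG,
    parallel_equiv hc hG, opposite_equiv hc hG]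

theorem choiceDecoder_equiv (hc : ∀ v, col v = W (f v)) (hG : ∀ u v, G u v ↔ H (f u) (f v)) :
    choiceDecoder G col = choiceDecoder H W := by
  ext x a b
  simp only [choiceDecoder, edge_equiv hc hG, nonedge_equiv hc hG]

theorem degDetermined_equiv (hc : ∀ v, col v = W (f v)) (hG : ∀ u v, G u v ↔ H (f u) (f v))
    (h : DegDetermined H W) : DegDetermined G col := by
  intro u v huv
  rw [hG, h _ _ (f.injective.ne huv), deg_equiv hc hG u, hc v, hc u]
  rw [ncard_setOf_equiv (q := fun r => W r = W (f v) ∧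
    deg H W (f v) (W (f u)) < deg H W r (W (f u))) f fun r => by
      rw [deg_equiv hc hG, deg_equiv hc hG, hc r]]

end Transport

/-- A bijection that preserves colors and color degrees preserves adjacency. -/
theorem adj_iff_of_deg_eq {G : V → V → Prop} {col : V → A} {H : P → P → Prop} {W : P → A}
    (f : V ≃ P) (hG : DegDetermined G col) (hH : DegDetermined H W) (hG' : ∀ v, ¬ G v v)
    (hH' : ∀ p, ¬ H p p) (hc : ∀ v, col v = W (f v))
    (hd : ∀ v b, deg G col v b = deg H W (f v) b) (u v : V) : G u v ↔ H (f u) (f v) := by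
  obtain rfl | huv := eq_or_ne u v
  · simp [hG', hH']
  rw [hG u v huv, hH _ _ (f.injective.ne huv), hd u, hc v, hc u]
  rw [ncard_setOf_equiv (q := fun r => W r = W (f v) ∧
    deg H W (f v) (W (f u)) < deg H W r (W (f u))) f fun r => by rw [hd, hd, hc r]]

/-! ### Color degrees in a letter graph as counts before or after a position -/

section LinearOrder

variable [LinearOrder P] {D : A → A → Prop} {W : P → A}

theorem LG_irrefl (p : P) : ¬ LG D W p p := by simp [LG]

theorem LG_symm {p q : P} : LG D W p q ↔ LG D W q p := by
  unfold LG; tauto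

theorem deg_LG_aft {p : P} {b : A} (h : D (W p) b) (h' : ¬ D b (W p)) :
    deg (LG D W) W p b = aft W p b := by
  rw [deg, aft]
  congr 1
  ext q
  simp only [LG, Set.mem_ofPred_eq, and_congr_left_iff]
  rintro rfl
  tauto

theorem deg_LG_bef {p : P} {b : A} (h : ¬ D (W p) b) (h' : D b (W p)) :
    deg (LG D W) W p b = bef W p b := by
  rw [deg, bef]
  congr 1
  ext q
  simp only [LG, Set.mem_ofPred_eq, and_congr_left_iff]
  rintro rfl
  tauto

theorem deg_LG_both {p : P} {b : A} (h : D (W p) b) (h' : D b (W p)) :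
    deg (LG D W) W p b = {q | q ≠ p ∧ W q = b}.ncard := by
  rw [deg]
  congr 1
  ext q
  simp only [LG, Set.mem_ofPred_eq, and_congr_left_iff]
  rintro rfl
  simp only [h, h', and_true, ne_comm (a := q), ne_iff_lt_or_gt]

/-- An edge needs one of the two words in the decoder, and a nonedge between distinct positions
needs one of them outside. -/
theorem active_LG {a b : A} (h : active (LG D W) W a b) : D a b ↔ ¬ D b a := by
  obtain ⟨⟨p, q, rfl, rfl, h1⟩, p', q', hne, hp, hq, h2⟩ := h
  unfold LG at h1 h2
  rw [hp, hq] at h2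
  rcases lt_or_gt_of_ne hne with h | h <;> tauto

theorem active_ne {a b : A} (h : active (LG D W) W a b) : a ≠ b := by
  rintro rfl
  have := active_LG h
  tauto

theorem aft_anti [Finite P] {p q : P} (h : p ≤ q) (b : A) : aft W q b ≤ aft W p b :=
  Set.ncard_le_ncard fun _ hr => ⟨h.trans_lt hr.1, hr.2⟩

theorem bef_mono [Finite P] {p q : P} (h : p ≤ q) (b : A) : bef W p b ≤ bef W q b :=
  Set.ncard_le_ncard fun _ hr => ⟨hr.1.trans_le h, hr.2⟩

theorem deg_LG_none [Finite P] {p : P} {b : A} (h : ¬ D (W p) b) (h' : ¬ D b (W p)) :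
    deg (LG D W) W p b = 0 := by
  rw [deg, Set.ncard_eq_zero]
  ext q
  simp only [LG, Set.mem_ofPred_eq, Set.mem_empty_iff_false, iff_false]
  rintro ⟨h1 | h1, rfl⟩ <;> tauto

theorem deg_LG_both_eq {p q : P} {b : A} (h : D (W p) b) (h' : D b (W p)) (e : W q = W p) :
    deg (LG D W) W q b = deg (LG D W) W p b := by
  rw [deg_LG_both h h', deg_LG_both (e ▸ h) (e ▸ h')]
  have key : ∀ r : P, {q | q ≠ r ∧ W q = b} = {q | W q = b} \ {r} := fun r => by
    ext; simp [and_comm]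
  rw [key, key]
  by_cases hb : W p = b
  · rw [Set.ncard_sdiff_singleton_of_mem (by simpa [e] using hb),
      Set.ncard_sdiff_singleton_of_mem (by simpa using hb)]
  · rw [Set.sdiff_singleton_eq_self (by simpa [e] using hb),
      Set.sdiff_singleton_eq_self (by simpa using hb)]

/-- The direction in which the color degrees of a letter graph vary. -/
theorem deg_LG_lt [Finite P] {p q : P} {b : A} (e : W q = W p)
    (h : deg (LG D W) W p b < deg (LG D W) W q b) :
    W p ≠ b ∧ (D (W p) b ↔ ¬ D b (W p)) ∧ (D (W p) b ↔ q < p) := by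
  by_cases h1 : D (W p) b <;> by_cases h2 : D b (W p)
  · rw [deg_LG_both_eq h1 h2 e] at h
    exact absurd h (lt_irrefl _)
  · refine ⟨by rintro rfl; exact h2 h1, by tauto, ?_⟩
    rw [deg_LG_aft h1 h2, deg_LG_aft (e ▸ h1) (e ▸ h2)] at h
    simp only [h1, true_iff]
    by_contra hc
    exact h.not_ge (aft_anti (not_lt.1 hc) b)
  · refine ⟨by rintro rfl; exact h1 h2, by tauto, ?_⟩
    rw [deg_LG_bef h1 h2, deg_LG_bef (e ▸ h1) (e ▸ h2)] at h
    simp only [h1, false_iff]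
    exact fun hc => h.not_ge (bef_mono hc.le b)
  · rw [deg_LG_none h1 h2, deg_LG_none (e ▸ h1) (e ▸ h2)] at h
    exact absurd h (lt_irrefl _)

/-- Suppose only the word `W p W q` is in the decoder, so that adjacency means `p < q` and the
right-hand side counts letters `W q` after `p`. Every `r` counted on the left has more letters `W p`
before it than `q`, so it lies after `q`. If `p < q`, these `r` lie after `p` too, and `q` itself is
one more. If `q < p`, each letter `W q` after `p` is counted on the left, because `p` is an
additional letter before it. The mirrored case is symmetric; with both words the left-hand set is
empty, with neither the right-hand side is zero. -/
theorem degDetermined_LG [Finite P] (D : A → A → Prop) (W : P → A) : DegDetermined (LG D W) W := by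
  intro p q hpq
  by_cases h1 : D (W p) (W q) <;> by_cases h2 : D (W q) (W p)
  · have h0 : {r | W r = W q ∧
        deg (LG D W) W q (W p) < deg (LG D W) W r (W p)} = ∅ := by
      ext r
      simp only [Set.mem_ofPred_eq, Set.mem_empty_iff_false, iff_false, not_and, not_lt]
      exact fun hr => (deg_LG_both_eq h2 h1 hr).le
    have hadj : LG D W p q := by
      rcases lt_or_gt_of_ne hpq with h | h
      · exact .inl ⟨h, h1⟩
      · exact .inr ⟨h, h2⟩
    rw [h0, Set.ncard_empty]
    simp only [hadj, true_iff]
    exact (Set.ncard_pos).2 ⟨q, hadj, rfl⟩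
  · have hadj : LG D W p q ↔ p < q := by simp [LG, h1, h2]
    rw [hadj, deg_LG_aft h1 h2, aft]
    have hset : {r | W r = W q ∧ deg (LG D W) W q (W p) < deg (LG D W) W r (W p)} =
        {r | W r = W q ∧ bef W q (W p) < bef W r (W p)} := by
      ext r
      simp only [Set.mem_ofPred_eq, and_congr_right_iff]
      intro hr
      rw [deg_LG_bef h2 h1, deg_LG_bef (hr ▸ h2) (hr ▸ h1)]
    rw [hset]
    constructor
    · intro h
      refine Set.ncard_lt_ncard ⟨fun r hr => ⟨?_, hr.1⟩, fun hs => ?_⟩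
      · by_contra hc
        exact hr.2.not_ge (bef_mono ((not_lt.1 hc).trans h.le) _)
      · exact (hs ⟨h, rfl⟩ : _ ∧ _).2.false
    · intro h
      by_contra hc
      have hqp : q < p := lt_of_le_of_ne (not_lt.1 hc) hpq.symm
      refine h.not_ge (Set.ncard_le_ncard fun r hr => ⟨hr.2, ?_⟩)
      refine Set.ncard_lt_ncard ⟨fun s hs => ⟨hs.1.trans (hqp.trans hr.1), hs.2⟩, fun hs => ?_⟩
      exact (hqp.trans (hs ⟨hr.1, rfl⟩ : _ ∧ _).1).false
  · have hadj : LG D W p q ↔ q < p := by simp [LG, h1, h2]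
    rw [hadj, deg_LG_bef h1 h2, bef]
    have hset : {r | W r = W q ∧ deg (LG D W) W q (W p) < deg (LG D W) W r (W p)} =
        {r | W r = W q ∧ aft W q (W p) < aft W r (W p)} := by
      ext r
      simp only [Set.mem_ofPred_eq, and_congr_right_iff]
      intro hr
      rw [deg_LG_aft h2 h1, deg_LG_aft (hr ▸ h2) (hr ▸ h1)]
    rw [hset]
    constructor
    · intro h
      refine Set.ncard_lt_ncard ⟨fun r hr => ⟨?_, hr.1⟩, fun hs => ?_⟩
      · by_contra hc
        exact hr.2.not_ge (aft_anti (h.le.trans (not_lt.1 hc)) _)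
      · exact (hs ⟨h, rfl⟩ : _ ∧ _).2.false
    · intro h
      by_contra hc
      have hqp : p < q := lt_of_le_of_ne (not_lt.1 hc) hpq
      refine h.not_ge (Set.ncard_le_ncard fun r hr => ⟨hr.2, ?_⟩)
      refine Set.ncard_lt_ncard ⟨fun s hs => ⟨(hr.1.trans hqp).trans hs.1, hs.2⟩, fun hs => ?_⟩
      exact ((hs ⟨hr.1, rfl⟩ : _ ∧ _).1.trans hqp).false
  · have hadj : ¬ LG D W p q := by simp [LG, h1, h2]
    rw [deg_LG_none h1 h2]
    simp [hadj]

/-- If `ab` is active and the decoder contains `ba`, degrees towards `b` in the class of `a` are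
exactly the counts `bef`; if it contains `ab`, they are the counts `aft`. So a failure to fit
decides the word. Parallel and opposite pairs follow from `deg_LG_lt`, as the decoder determines
whether degrees grow or fall along the word. -/
theorem consistent_LG [Finite P] (D : A → A → Prop) (W : P → A) :
    Consistent (LG D W) W W fun a b => a = b ∨ D a b := by
  intro a b c d
  constructor
  · rintro (⟨rfl, rfl⟩ | ⟨hact, hfit, rfl, rfl⟩ | ⟨rfl, p, q, rfl, hq, h1, h2⟩)
    · simp
    · simp only [active_ne hact, false_or, true_or, iff_true]
      by_contra h
      have h' : D b d := by by_contra h'; exact h ((active_LG hact).2 h')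
      refine hfit fun e => ?_
      congr 1
      ext p
      simp only [Set.mem_ofPred_eq, and_congr_right_iff]
      rintro rfl
      rw [deg_LG_bef h h']
    · obtain ⟨n1, -, i1⟩ := deg_LG_lt hq h1
      obtain ⟨n2, -, i2⟩ := deg_LG_lt hq h2
      simp [n1, n2, i1, i2]
  · rintro (⟨hact, rfl, rfl⟩ | ⟨hact, hfit, rfl, rfl⟩ | ⟨rfl, p, q, rfl, hq, h1, h2⟩)
    · simpa [active_ne hact, (active_ne hact).symm] using active_LG hact
    · simp only [active_ne hact, false_or, true_or, not_true, iff_false]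
      intro h
      have h' := (active_LG hact).1 h
      refine hfit fun e => ?_
      congr 1
      ext p
      simp only [Set.mem_ofPred_eq, and_congr_right_iff]
      rintro rfl
      rw [deg_LG_aft h h']
    · obtain ⟨n1, -, i1⟩ := deg_LG_lt hq h1
      obtain ⟨n2, -, i2⟩ := deg_LG_lt hq.symm h2
      rw [hq] at n2 i2
      simp only [n1, n2, i1, i2, false_or, not_lt]
      refine ⟨le_of_lt, fun h => lt_of_le_of_ne h ?_⟩
      rintro rfl
      exact h1.false

/-! ### Reversal of a color class -/

/-- Two antitone functions on a finite linear order with the same distribution are equal. -/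
theorem eq_of_anti_of_ncard_eq [Finite P] {S : Set P} {g h : P → ℕ}
    (hg : ∀ p ∈ S, ∀ q ∈ S, p ≤ q → g q ≤ g p) (hh : ∀ p ∈ S, ∀ q ∈ S, p ≤ q → h q ≤ h p)
    (hd : ∀ d, {p | p ∈ S ∧ d ≤ g p}.ncard = {p | p ∈ S ∧ d ≤ h p}.ncard) :
    ∀ p ∈ S, g p = h p := by
  have key : ∀ d, ∀ p ∈ S, d ≤ g p ↔ d ≤ h p := by
    suffices H : ∀ d, {p | p ∈ S ∧ d ≤ g p} = {p | p ∈ S ∧ d ≤ h p} by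
      intro d p hp
      simpa [hp] using Set.ext_iff.1 (H d) p
    intro d
    -- Superlevel sets of antitone functions are initial segments of `S`, hence nested; having equal
    -- size, they coincide.
    by_cases hs : {p | p ∈ S ∧ d ≤ g p} ⊆ {p | p ∈ S ∧ d ≤ h p}
    · exact Set.eq_of_subset_of_ncard_le hs (hd d).ge
    · obtain ⟨p, ⟨hp, hpg⟩, hph⟩ := Set.not_subset.1 hs
      have hs' : {p | p ∈ S ∧ d ≤ h p} ⊆ {p | p ∈ S ∧ d ≤ g p} := by
        refine fun q hq => ⟨hq.1, ?_⟩
        rcases le_total q p with hqp | hpq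
        · exact hpg.trans (hg q hq.1 p hp hqp)
        · exact (hph ⟨hp, hq.2.trans (hh p hp q hq.1 hpq)⟩).elim
      exact (Set.eq_of_subset_of_ncard_le hs' (hd d).le).symm
  exact fun p hp => le_antisymm ((key _ p hp).1 le_rfl) ((key _ p hp).2 le_rfl)

theorem exists_reversal [Finite P] (S : Set P) : ∃ ρ : P → P,
    ∀ p ∈ S, ρ p ∈ S ∧ ρ (ρ p) = p ∧ ∀ q ∈ S, p ≤ q → ρ q ≤ ρ p := by
  classical
  have := Fintype.ofFinite P
  let e := S.toFinset.orderIsoOfFin rfl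
  have he : ∀ i, (e i : P) ∈ S := fun i => Set.mem_toFinset.1 (e i).2
  refine ⟨fun p => if hp : p ∈ S then
    e (Fin.rev (e.symm ⟨p, Set.mem_toFinset.2 hp⟩)) else p, fun p hp => ⟨?_, ?_, ?_⟩⟩
  · simp [hp, he]
  · simp [hp, he]
  · intro q hq hpq
    simp [hp, hq, hpq]

/-- If the numbers of letters `b` after and before the positions with letter `a` have the same
distribution, then the subword of the letters `a` and `b` is a palindrome. -/
theorem aft_eq_bef_reversal [Finite P] {a b : A} {ρ : P → P}
    (hρ : ∀ p, W p = a → W (ρ p) = a ∧ ρ (ρ p) = p ∧ ∀ q, W q = a → p ≤ q → ρ q ≤ ρ p)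
    (h : ∀ d, {p | W p = a ∧ d ≤ aft W p b}.ncard = {p | W p = a ∧ d ≤ bef W p b}.ncard) :
    ∀ p, W p = a → aft W p b = bef W (ρ p) b := by
  -- Both `aft` and `bef` after `ρ` are antitone on the class, and `ρ` permutes the class, so it
  -- does not change the distribution of `bef`.
  refine eq_of_anti_of_ncard_eq (S := {p | W p = a}) (fun p _ q _ hpq => aft_anti hpq b)
    (fun p hp q hq hpq => bef_mono ((hρ p hp).2.2 q hq hpq) b) fun d => (h d).trans ?_
  refine Set.ncard_congr (fun p _ => ρ p) (fun p hp => ?_) (fun p q hp hq e => ?_) fun p hp => ?_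
  · exact ⟨(hρ p hp.1).1, by simpa [(hρ p hp.1).2.1] using hp.2⟩
  · rw [← (hρ p hp.1).2.1, e, (hρ q hq.1).2.1]
  · exact ⟨ρ p, ⟨(hρ p hp.1).1, hp.2⟩, (hρ p hp.1).2.1⟩

/-- Some neighbor `r` of `q` with letter `b` is not a neighbor of `p`. It supplies the edge and the
nonedge; `r ≠ p` because the letter of `p` is not `b`. -/
theorem active_of_deg_lt [Finite P] {p q : P} (e : W q = W p) {b : A}
    (h : deg (LG D W) W p b < deg (LG D W) W q b) : active (LG D W) W (W p) b := by
  obtain ⟨hne, -, -⟩ := deg_LG_lt e h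
  have : ¬ {u | LG D W q u ∧ W u = b} ⊆ {u | LG D W p u ∧ W u = b} := fun hs =>
    h.not_ge (Set.ncard_le_ncard hs)
  obtain ⟨r, ⟨hr, hb⟩, hr'⟩ := Set.not_subset.1 this
  refine ⟨⟨q, r, e, hb, hr⟩, p, r, ?_, rfl, hb, fun h' => hr' ⟨h', hb⟩⟩
  rintro rfl
  exact hne hb

theorem active_of_deg_ne [Finite P] {p q : P} (e : W q = W p) {b : A}
    (h : deg (LG D W) W p b ≠ deg (LG D W) W q b) : active (LG D W) W (W p) b := by
  rcases lt_or_gt_of_ne h with h | h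
  · exact active_of_deg_lt e h
  · rw [← e]
    exact active_of_deg_lt e.symm h

/-- If the first and the last position with letter `a` have the same number of neighbors of color
`b`, then so do all positions with letter `a`. -/
theorem deg_LG_eq_of_ends [Finite P] {p q r : P} {b : A} (hq : W q = W p) (hr : W r = W p) (hpr : p ≤ r)
    (hrq : r ≤ q) (h : deg (LG D W) W p b = deg (LG D W) W q b) :
    deg (LG D W) W r b = deg (LG D W) W p b := by
  by_contra hne
  rcases lt_or_gt_of_ne hne with hlt | hlt
  -- Degrees would fall from `p` to `r` and rise from `r` to `q`, but the decoder permits one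
  -- direction only.
  · have h1 := deg_LG_lt hr.symm hlt
    have h2 := deg_LG_lt (hq.trans hr.symm) (h ▸ hlt)
    exact (h2.2.2.1 (h1.2.2.2 (lt_of_le_of_ne hpr (by rintro rfl; exact hlt.false)))).not_ge hrq
  · have h1 := deg_LG_lt hr hlt
    have h2 := deg_LG_lt (hr.trans hq.symm) (h ▸ hlt)
    rw [hq] at h2
    exact (h1.2.2.1 (h2.2.2.2 (lt_of_le_of_ne hrq (by
      rintro rfl; rw [h] at hlt; exact hlt.false)))).not_ge hpr

/-! ### Consistent choices versus a given decoder -/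

section Choice

variable {x : A → A → Prop}

/-- Without a nonedge the two classes are completely joined and the new decoder has both words;
without an edge it has neither. -/
theorem deg_choice_of_not_active {a b : A} (h : ¬ active (LG D W) W a b) {p : P} (hp : W p = a) :
    deg (LG (choiceDecoder (LG D W) W x) W) W p b = deg (LG D W) W p b := by
  rw [deg, deg]
  congr 1
  ext q
  simp only [Set.mem_ofPred_eq, and_congr_left_iff]
  rintro rfl
  subst hp
  by_cases he : edge (LG D W) W (W p) (W q)
  · have hn : ¬ nonedge (LG D W) W (W p) (W q) := fun hn => h ⟨he, hn⟩
    have he' : edge (LG D W) W (W q) (W p) := by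
      obtain ⟨u, v, hu, hv, huv⟩ := he
      exact ⟨v, u, hv, hu, LG_symm.1 huv⟩
    have hn' : ¬ nonedge (LG D W) W (W q) (W p) := by
      rintro ⟨u, v, hne, hu, hv, huv⟩
      exact hn ⟨v, u, hne.symm, hv, hu, fun h => huv (LG_symm.1 h)⟩
    have h1 : choiceDecoder (LG D W) W x (W p) (W q) := ⟨he, .inl hn⟩
    have h2 : choiceDecoder (LG D W) W x (W q) (W p) := ⟨he', .inl hn'⟩
    have h3 : LG D W p q ↔ p ≠ q := ⟨by rintro h rfl; exact LG_irrefl _ h, fun h => by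
      by_contra h'; exact hn ⟨p, q, h, rfl, rfl, h'⟩⟩
    rw [h3]
    simp only [LG, h1, h2, and_true, ne_iff_lt_or_gt]
  · have he' : ¬ edge (LG D W) W (W q) (W p) := by
      rintro ⟨u, v, hu, hv, huv⟩
      exact he ⟨v, u, hv, hu, LG_symm.1 huv⟩
    have h3 : ¬ LG D W p q := fun h => he ⟨p, q, rfl, rfl, h⟩
    simp only [h3, iff_false]
    simp [LG, choiceDecoder, he, he']

theorem active_comm {a b : A} (h : active (LG D W) W a b) : active (LG D W) W b a := by
  obtain ⟨⟨u, v, hu, hv, huv⟩, u', v', hne, hu', hv', huv'⟩ := h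
  exact ⟨⟨v, u, hv, hu, LG_symm.1 huv⟩, v', u', hne.symm, hv', hu', fun h => huv' (LG_symm.1 h)⟩

theorem choice_of_active {a b : A} (h : active (LG D W) W a b) :
    choiceDecoder (LG D W) W x a b ↔ x a b := by
  simp [choiceDecoder, h.1, h.2]

theorem choice_of_active_comm (hx : Consistent (LG D W) W W x) {a b : A}
    (h : active (LG D W) W a b) : choiceDecoder (LG D W) W x b a ↔ ¬ x a b := by
  rw [choice_of_active (active_comm h), (hx a b b a).2 (.inl ⟨h, rfl, rfl⟩), not_not]

/-- If the choice agrees with the decoder on an active pair, then the color degrees agree. -/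
theorem deg_choice_of_iff [Finite P] (hx : Consistent (LG D W) W W x) {a b : A}
    (h : active (LG D W) W a b) (hD : D a b ↔ x a b) {p : P} (hp : W p = a) :
    deg (LG (choiceDecoder (LG D W) W x) W) W p b = deg (LG D W) W p b := by
  subst hp
  have h1 := active_LG h
  have h2 := choice_of_active (x := x) h
  have h3 := choice_of_active_comm hx h
  by_cases hxab : x (W p) b
  · rw [deg_LG_aft (h2.2 hxab) (fun h => h3.1 h hxab), deg_LG_aft (hD.2 hxab) (h1.1 (hD.2 hxab))]
  · have h4 : ¬ D (W p) b := fun h => hxab (hD.1 h)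
    rw [deg_LG_bef (fun h => hxab (h2.1 h)) (h3.2 hxab), deg_LG_bef h4 (by tauto)]

/-- If the choice differs from the decoder on an active pair, then the color degrees are
reversed. -/
theorem deg_choice_reversal [Finite P] (hx : Consistent (LG D W) W W x) (hx' : ∀ a, x a a)
    {a b : A} (h : active (LG D W) W a b) (hD : ¬ (D a b ↔ x a b)) {ρ : P → P}
    (hρ : ∀ p, W p = a → W (ρ p) = a ∧ ρ (ρ p) = p ∧ ∀ q, W q = a → p ≤ q → ρ q ≤ ρ p)
    {p : P} (hp : W p = a) :
    deg (LG (choiceDecoder (LG D W) W x) W) W (ρ p) b = deg (LG D W) W p b := by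
  have h1 := active_LG h
  have h2 := choice_of_active (x := x) h
  have h3 := choice_of_active_comm hx h
  have hρp := hρ p hp
  by_cases hxab : x a b
  · have h4 : ¬ D a b := by tauto
    have h5 : D b a := by by_contra h5; exact h4 (h1.2 h5)
    -- The choice takes `ab`, so consistency excludes a failure of `aft` to fit. The degrees are in
    -- fact the counts `bef`, so the two distributions agree and the palindrome lemma applies.
    have hfit : Fits (LG D W) W W (aft W) a b := by
      by_contra hf
      exact ((hx a b a a).2 (.inr (.inl ⟨h, hf, rfl, rfl⟩))).1 hxab (hx' a)
    rw [deg_LG_aft (by rw [hρp.1]; exact h2.2 hxab) (by rw [hρp.1]; exact fun h => h3.1 h hxab),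
      deg_LG_bef (hp ▸ h4) (hp ▸ h5)]
    rw [aft_eq_bef_reversal hρ (fun d => ?_) _ hρp.1, hρp.2.1]
    rw [← hfit d]
    congr 1
    ext q
    simp only [Set.mem_ofPred_eq, and_congr_right_iff]
    intro hq
    rw [deg_LG_bef (hq ▸ h4) (hq ▸ h5)]
  · have h4 : D a b := by tauto
    have h5 := h1.1 h4
    have hfit : Fits (LG D W) W W (bef W) a b := by
      by_contra hf
      exact hxab (((hx a b a a).1 (.inr (.inl ⟨h, hf, rfl, rfl⟩))).2 (hx' a))
    rw [deg_LG_bef (by rw [hρp.1]; exact fun h => hxab (h2.1 h))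
      (by rw [hρp.1]; exact h3.2 hxab), deg_LG_aft (hp ▸ h4) (hp ▸ h5)]
    rw [aft_eq_bef_reversal hρ (fun d => ?_) _ hp]
    rw [← hfit d]
    congr 1
    ext q
    simp only [Set.mem_ofPred_eq, and_congr_right_iff]
    intro hq
    rw [deg_LG_aft (hq ▸ h4) (hq ▸ h5)]

/-- On each color class, either the identity or the reversal preserves all color degrees. -/
theorem deg_choice_eq_or_reversal [Finite P] (hx : Consistent (LG D W) W W x)
    (hx' : ∀ a, x a a) {a : A} {ρ : P → P}
    (hρ : ∀ p, W p = a → W (ρ p) = a ∧ ρ (ρ p) = p ∧ ∀ q, W q = a → p ≤ q → ρ q ≤ ρ p) :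
    (∀ p, W p = a → ∀ b, deg (LG (choiceDecoder (LG D W) W x) W) W p b = deg (LG D W) W p b) ∨
    (∀ p, W p = a → ∀ b,
      deg (LG (choiceDecoder (LG D W) W x) W) W (ρ p) b = deg (LG D W) W p b) := by
  by_contra hcon
  push Not at hcon
  -- The letter `b` witnesses that the identity fails, `c` that the reversal fails. Thus choice and
  -- decoder disagree on `ab`, and degrees towards `c` are unchanged.
  obtain ⟨⟨p, hp, b, hb⟩, q, hq, c, hc⟩ := hcon
  have hactb : active (LG D W) W a b := by
    by_contra h; exact hb (deg_choice_of_not_active h hp)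
  have hDb : ¬ (D a b ↔ x a b) := fun h => hb (deg_choice_of_iff hx hactb h hp)
  have hEc : ∀ r, W r = a →
      deg (LG (choiceDecoder (LG D W) W x) W) W r c = deg (LG D W) W r c := by
    intro r hr
    by_cases h : active (LG D W) W a c
    · refine deg_choice_of_iff hx h ?_ hr
      by_contra hD
      exact hc (deg_choice_reversal hx hx' h hD hρ hq)
    · exact deg_choice_of_not_active h hr
  obtain ⟨p₁, hp₁, hmin⟩ := Set.exists_min_image {r | W r = a} id (Set.toFinite _) ⟨p, hp⟩
  obtain ⟨p₂, hp₂, hmax⟩ := Set.exists_max_image {r | W r = a} id (Set.toFinite _) ⟨p, hp⟩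
  simp only [Set.mem_ofPred_eq, id_eq] at hp₁ hp₂ hmin hmax
  have hconst : ∀ e, deg (LG D W) W p₁ e = deg (LG D W) W p₂ e → ∀ r, W r = a →
      deg (LG D W) W r e = deg (LG D W) W p₁ e := fun e he r hr =>
    deg_LG_eq_of_ends (hp₂.trans hp₁.symm) (hr.trans hp₁.symm) (hmin r hr) (hmax r hr) he
  -- Equal degrees at the first and last position would make the degree constant on the class; then
  -- identity and reversal could not be distinguished.
  have hb₁ : deg (LG D W) W p₁ b ≠ deg (LG D W) W p₂ b := fun he => by
    have := deg_choice_reversal hx hx' hactb hDb hρ (hρ p hp).1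
    rw [(hρ p hp).2.1, hconst b he _ (hρ p hp).1, ← hconst b he p hp] at this
    exact hb this
  have hc₁ : deg (LG D W) W p₁ c ≠ deg (LG D W) W p₂ c := fun he => by
    apply hc
    rw [hEc _ (hρ q hq).1, hconst c he _ (hρ q hq).1, hconst c he _ hq]
  have hactc : active (LG D W) W a c := hp₁ ▸ active_of_deg_ne (hp₂.trans hp₁.symm) hc₁
  have hDc : D a c ↔ x a c := by
    by_contra h
    exact hc (deg_choice_reversal hx hx' hactc h hρ hq)
  have h1 := hx a b a c
  have h2 := consistent_LG D W a b a c
  simp only [active_ne hactb, active_ne hactc, false_or] at h2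
  -- The first and last positions of the class show that degrees towards `b` and `c` vary in
  -- parallel or oppositely. Choice and decoder both obey this condition, yet they agree on `ac` and
  -- disagree on `ab`.
  have h3 : MustAgree (LG D W) W W a b a c ∨ MustDiffer (LG D W) W W a b a c := by
    rcases lt_or_gt_of_ne hb₁ with hb₁ | hb₁ <;> rcases lt_or_gt_of_ne hc₁ with hc₁ | hc₁
    · exact .inl (.inr (.inr ⟨rfl, p₁, p₂, hp₁, hp₂, hb₁, hc₁⟩))
    · exact .inr (.inr (.inr ⟨rfl, p₁, p₂, hp₁, hp₂, hb₁, hc₁⟩))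
    · exact .inr (.inr (.inr ⟨rfl, p₂, p₁, hp₂, hp₁, hb₁, hc₁⟩))
    · exact .inl (.inr (.inr ⟨rfl, p₂, p₁, hp₂, hp₁, hb₁, hc₁⟩))
  rcases h3 with h3 | h3
  · have := h1.1 h3
    have := h2.1 h3
    tauto
  · have := h1.2 h3
    have := h2.2 h3
    tauto

/-- A permutation of the positions that preserves letters and takes the color degrees of a letter
graph to those of the decoder of a consistent choice. -/
theorem exists_perm_deg_choice [Finite P] (hx : Consistent (LG D W) W W x) (hx' : ∀ a, x a a) :
    ∃ π : P ≃ P, ∀ p, W p = W (π p) ∧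
      ∀ b, deg (LG D W) W p b = deg (LG (choiceDecoder (LG D W) W x) W) W (π p) b := by
  classical
  choose ρ hρ using fun a => exists_reversal {p | W p = a}
  simp only [Set.mem_ofPred_eq] at hρ
  let keep : A → Prop := fun a => ∀ p, W p = a → ∀ b,
    deg (LG (choiceDecoder (LG D W) W x) W) W p b = deg (LG D W) W p b
  -- Degrees in a letter graph are attached to positions and do not depend on how other positions
  -- are matched, so identity or reversal can be selected separately for every letter.
  let π : P → P := fun p => if keep (W p) then p else ρ (W p) p
  have hW : ∀ p, W (π p) = W p := fun p => by
    by_cases h : keep (W p)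
    · simp [π, h]
    · simpa [π, h] using (hρ (W p) p rfl).1
  have hπ : Function.Involutive π := fun p => by
    have : π (π p) = if keep (W p) then π p else ρ (W p) (π p) := by
      conv_lhs => rw [show π (π p) = if keep (W (π p)) then π p else ρ (W (π p)) (π p) from rfl, hW]
    rw [this]
    by_cases h : keep (W p)
    · simp [π, h]
    · simpa [π, h] using (hρ (W p) p rfl).2.1
  refine ⟨hπ.toPerm, fun p => ⟨(hW p).symm, fun b => ?_⟩⟩
  change _ = deg _ W (π p) b
  by_cases h : keep (W p)
  · simpa [π, h] using (h p rfl b).symm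
  · have := (deg_choice_eq_or_reversal hx hx' (hρ (W p))).resolve_left h
    simpa [π, h] using (this p rfl b).symm

end Choice

end LinearOrder

/-! ### Solutions -/

section Solutions

/-- Choose an injection on each fiber of `g` into the fiber of `h` over the same value. Together
they form an injection, bijective because the total sizes agree; hence one-sided inequalities are
enough. -/
theorem exists_equiv_of_ncard_le [Finite V] [Finite P] {B : Type*} (hcard : Nat.card V = Nat.card P)
    {g : V → B} {h : P → B} (hle : ∀ v, {u | g u = g v}.ncard ≤ {p | h p = g v}.ncard) :
    ∃ f : V ≃ P, ∀ v, h (f v) = g v := by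
  rcases isEmpty_or_nonempty P with hP | hP
  · have : IsEmpty V := by
      rw [← Finite.card_eq_zero_iff, hcard, Finite.card_eq_zero_iff]
      exact hP
    exact ⟨Equiv.equivOfIsEmpty V P, fun v => isEmptyElim v⟩
  have key : ∀ b, ∃ F : V → P, (∀ v, g v = b → h (F v) = b) ∧ Set.InjOn F {v | g v = b} := by
    intro b
    by_cases hb : ∃ v, g v = b
    · obtain ⟨v, rfl⟩ := hb
      obtain ⟨F, h1, h2⟩ := (Set.toFinite {u | g u = g v}).exists_injOn_of_encard_le
        (t := {p | h p = g v}) (by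
          rw [← (Set.toFinite _).cast_ncard_eq, ← (Set.toFinite _).cast_ncard_eq]
          exact_mod_cast hle v)
      exact ⟨F, fun u hu => h1 hu, h2⟩
    · exact ⟨fun _ => hP.some, fun v hv => (hb ⟨v, hv⟩).elim, fun v hv => (hb ⟨v, hv⟩).elim⟩
  choose F hF hF' using key
  have hinj : Function.Injective fun v => F (g v) v := by
    intro u v huv
    have e : g u = g v := by rw [← hF _ u rfl, ← hF _ v rfl]; exact congrArg h huv
    simp only [e] at huv
    exact hF' _ e rfl huv
  refine ⟨Equiv.ofBijective _ (hinj.bijective_of_nat_card_le hcard.ge), fun v => hF _ v rfl⟩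

variable [LinearOrder P] [Finite P] {G : V → V → Prop} {col : V → A} {W : P → A}
  {D : A → A → Prop} {x : A → A → Prop}

theorem Sol.consistent (h : Sol G col W D) : Consistent G col W fun a b => a = b ∨ D a b := by
  obtain ⟨f, hc, hG⟩ := h
  rw [consistent_equiv W hc hG]
  exact consistent_LG D W

theorem Sol.degDetermined (h : Sol G col W D) : DegDetermined G col := by
  obtain ⟨f, hc, hG⟩ := h
  exact degDetermined_equiv hc hG (degDetermined_LG D W)

/-- If there is a solution, then every consistent choice gives a solution. -/
theorem Sol.choice (h : Sol G col W D) (hx : Consistent G col W x) (hx' : ∀ a, x a a) :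
    Sol G col W (choiceDecoder G col x) := by
  have hdet := h.degDetermined
  obtain ⟨f, hc, hG⟩ := h
  rw [consistent_equiv W hc hG] at hx
  obtain ⟨π, hπ⟩ := exists_perm_deg_choice hx hx'
  rw [choiceDecoder_equiv hc hG]
  have hc' : ∀ v, col v = W (f.trans π v) := fun v => (hc v).trans (hπ (f v)).1
  -- The given isomorphism followed by the permutation of positions preserves colors and color
  -- degrees, which is all an isomorphism needs.
  refine ⟨f.trans π, hc', adj_iff_of_deg_eq _ hdet (degDetermined_LG _ _) (fun v => ?_)
    LG_irrefl hc' fun v b => ?_⟩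
  · rw [hG]
    exact LG_irrefl _
  · rw [deg_equiv hc hG]
    exact (hπ (f v)).2 b

/-- A solution is recognized by its color degrees. -/
theorem sol_iff [Finite V] (hcard : Nat.card V = Nat.card P) (hirr : ∀ v, ¬ G v v) :
    Sol G col W D ↔ DegDetermined G col ∧ ∀ v,
      {u | col u = col v ∧ ∀ b, deg G col u b = deg G col v b}.ncard ≤
        {p | W p = col v ∧ ∀ b, deg (LG D W) W p b = deg G col v b}.ncard := by
  constructor
  · refine fun h => ⟨h.degDetermined, fun v => ?_⟩
    obtain ⟨f, hc, hG⟩ := h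
    refine (ncard_setOf_equiv f fun u => ?_).le
    simp only [hc u, deg_equiv hc hG u]
  · rintro ⟨hdet, hle⟩
    obtain ⟨f, hf⟩ := exists_equiv_of_ncard_le hcard (g := fun v => (col v, deg G col v))
      (h := fun p => (W p, deg (LG D W) W p)) fun v => by
        simpa only [Prod.mk.injEq, funext_iff] using hle v
    simp only [Prod.mk.injEq, funext_iff] at hf
    have hc : ∀ v, col v = W (f v) := fun v => (hf v).1.symm
    exact ⟨f, hc, adj_iff_of_deg_eq f hdet (degDetermined_LG _ _) hirr LG_irrefl hc
      fun v b => ((hf v).2 b).symm⟩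

end Solutions

/-! ### The algorithm on the memory of the machine -/

open RAM

/-! #### Reading the input -/

def mAdj (m : ℕ → ℕ) (n u v : ℕ) : Prop := m (2 + n + n + (n * u + v)) = 1

def mCol (m : ℕ → ℕ) (v : ℕ) : ℕ := m (2 + v)

def mWord (m : ℕ → ℕ) (n p : ℕ) : ℕ := m (2 + n + p)

noncomputable def mDeg (m : ℕ → ℕ) (n v b : ℕ) : ℕ :=
  count n fun u => mAdj m n v u ∧ mCol m u = b

noncomputable def mAft (m : ℕ → ℕ) (n p b : ℕ) : ℕ := count n fun q => p < q ∧ mWord m n q = b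

noncomputable def mBef (m : ℕ → ℕ) (n p b : ℕ) : ℕ := count n fun q => q < p ∧ mWord m n q = b

def mEdge (m : ℕ → ℕ) (n a b : ℕ) : Prop :=
  ∃ u < n, ∃ v < n, mCol m u = a ∧ mCol m v = b ∧ mAdj m n u v

def mNonedge (m : ℕ → ℕ) (n a b : ℕ) : Prop :=
  ∃ u < n, ∃ v < n, ¬ u = v ∧ mCol m u = a ∧ mCol m v = b ∧ ¬ mAdj m n u v

def mFitsAft (m : ℕ → ℕ) (n a b : ℕ) : Prop :=
  ∀ d < n + 1, (count n fun v => mCol m v = a ∧ d ≤ mDeg m n v b) =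
    count n fun p => mWord m n p = a ∧ d ≤ mAft m n p b

def mFitsBef (m : ℕ → ℕ) (n a b : ℕ) : Prop :=
  ∀ d < n + 1, (count n fun v => mCol m v = a ∧ d ≤ mDeg m n v b) =
    count n fun p => mWord m n p = a ∧ d ≤ mBef m n p b

def mParallel (m : ℕ → ℕ) (n a b d : ℕ) : Prop :=
  ∃ v < n, ∃ v' < n, mCol m v = a ∧ mCol m v' = a ∧ mDeg m n v b < mDeg m n v' b ∧
    mDeg m n v d < mDeg m n v' d

def mOpposite (m : ℕ → ℕ) (n a b d : ℕ) : Prop :=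
  ∃ v < n, ∃ v' < n, mCol m v = a ∧ mCol m v' = a ∧ mDeg m n v b < mDeg m n v' b ∧
    mDeg m n v' d < mDeg m n v d

def mAgree (m : ℕ → ℕ) (n a b c d : ℕ) : Prop :=
  (a = b ∧ c = d) ∨
    ((mEdge m n a b ∧ mNonedge m n a b) ∧ ¬ mFitsBef m n a b ∧ c = a ∧ d = a) ∨
    (a = c ∧ mParallel m n a b d)

def mDiffer (m : ℕ → ℕ) (n a b c d : ℕ) : Prop :=
  ((mEdge m n a b ∧ mNonedge m n a b) ∧ c = b ∧ d = a) ∨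
    ((mEdge m n a b ∧ mNonedge m n a b) ∧ ¬ mFitsAft m n a b ∧ c = a ∧ d = a) ∨
    (a = c ∧ mOpposite m n a b d)

/-- The array of the signed representatives begins here. -/
def base (n k : ℕ) : ℕ := 2 + n + n + n * n + k * k

/-- The array with the decoder begins here. -/
def base' (n k : ℕ) : ℕ := base n k + k * k

def mDec (m : ℕ → ℕ) (n k a b : ℕ) : Prop := m (base' n k + (k * a + b)) = 1

def mLG (m : ℕ → ℕ) (n k p q : ℕ) : Prop :=
  (p < q ∧ mDec m n k (mWord m n p) (mWord m n q)) ∨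
    (q < p ∧ mDec m n k (mWord m n q) (mWord m n p))

noncomputable def mDegLG (m : ℕ → ℕ) (n k p b : ℕ) : ℕ :=
  count n fun q => mLG m n k p q ∧ mWord m n q = b

def mCheck (m : ℕ → ℕ) (n k : ℕ) : Prop :=
  (∀ u < n, ∀ v < n, ¬ u = v → (mAdj m n u v ↔
    (count n fun r => mCol m r = mCol m v ∧ mDeg m n v (mCol m u) < mDeg m n r (mCol m u)) <
      mDeg m n u (mCol m v))) ∧
  ∀ v < n, (count n fun u => mCol m u = mCol m v ∧ ∀ b < k, mDeg m n u b = mDeg m n v b) ≤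
    count n fun p => mWord m n p = mCol m v ∧ ∀ b < k, mDegLG m n k p b = mDeg m n v b

def mChoice (m : ℕ → ℕ) (n k a b : ℕ) : Prop :=
  mEdge m n a b ∧ (¬ mNonedge m n a b ∨
    (m (base n k + (k * a + b)) < k * k ↔ m (base n k + (k * a + a)) < k * k))

/-- The quotient of `x < k * k` by `k`. -/
noncomputable def quo (k x : ℕ) : ℕ := count k fun i => k * (i + 1) ≤ x

noncomputable def rem (k x : ℕ) : ℕ := x - k * quo k x

/-! #### The transformations of the memory -/

/-- The negative of a signed representative. -/
def opp (k c : ℕ) : ℕ := (k * k + k * k - 1) - c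

/-- Replace the signed representative `A` by `C`, and its negative by the negative of `C`. -/
def replace (k A C y : ℕ) : ℕ :=
  if y = A then C else if y = opp k A then opp k C else y

def merge (n k A C : ℕ) (m : ℕ → ℕ) : ℕ → ℕ :=
  iter (fun x m => Function.update m (base n k + x) (replace k A C (m (base n k + x))))
    (k * k) m

open Classical in
noncomputable def agreeStep (n k u v : ℕ) (m : ℕ → ℕ) : ℕ → ℕ :=
  if mAgree m n (quo k u) (rem k u) (quo k v) (rem k v) then
    merge n k (m (base n k + u)) (m (base n k + v)) m else m

open Classical in
noncomputable def differStep (n k u v : ℕ) (m : ℕ → ℕ) : ℕ → ℕ :=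
  if mDiffer m n (quo k u) (rem k u) (quo k v) (rem k v) then
    merge n k (m (base n k + u)) (opp k (m (base n k + v))) m else m

def start (n k : ℕ) (m : ℕ → ℕ) : ℕ → ℕ :=
  iter (fun x m => Function.update m (base n k + x) x) (k * k) m

noncomputable def propagate (n k : ℕ) (m : ℕ → ℕ) : ℕ → ℕ :=
  iter (fun u => iter (fun v m => differStep n k u v (agreeStep n k u v m)) (k * k)) (k * k) m

noncomputable def decode (n k : ℕ) (m : ℕ → ℕ) : ℕ → ℕ :=
  iter (fun x m => Function.update m (base' n k + x)
    (ind (mChoice m n k (quo k x) (rem k x)))) (k * k) m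

noncomputable def output (n k : ℕ) (m : ℕ → ℕ) : ℕ → ℕ :=
  Function.update (iter (fun x m => Function.update m (1 + x) (m (base' n k + x))) (k * k) m) 0
    (ind (mCheck m n k))

noncomputable def solve (n k : ℕ) (m : ℕ → ℕ) : ℕ → ℕ :=
  output n k (decode n k (propagate n k (start n k m)))

/-! #### Running times -/

section Comp

variable {u v a b d e : Env → (ℕ → ℕ) → ℕ} {p : Env → (ℕ → ℕ) → Prop}

theorem n_le_size (c : Env) : c.n ≤ (Polynomial.X : Polynomial ℕ).eval c.size := by
  simp [Env.size]

theorem k_le_size (c : Env) : c.k ≤ (Polynomial.X : Polynomial ℕ).eval c.size := by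
  simp [Env.size]

theorem comp_countN (hp : CompP p) : Comp fun c m => count c.n fun i => p (c.push i) m :=
  .count .X (fun c _ => n_le_size c) .n hp

theorem compP_exN (hp : CompP p) : CompP fun c m => ∃ i < c.n, p (c.push i) m :=
  .ex .X (fun c _ => n_le_size c) .n hp

theorem compP_allN (hp : CompP p) : CompP fun c m => ∀ i < c.n, p (c.push i) m :=
  .all .X (fun c _ => n_le_size c) .n hp

theorem compP_allK (hp : CompP p) : CompP fun c m => ∀ i < c.k, p (c.push i) m :=
  .all .X (fun c _ => k_le_size c) .k hp

theorem comp_nmul (hu : Comp u) : Comp fun c m => c.n * u c m :=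
  .mul .X (fun c _ => n_le_size c) .n hu

theorem comp_kmul (hu : Comp u) : Comp fun c m => c.k * u c m :=
  .mul .X (fun c _ => k_le_size c) .k hu

theorem compS_loopKK {F : Env → (ℕ → ℕ) → ℕ → ℕ} (hF : CompS F) :
    CompS fun c m => iter (fun i => F (c.push i)) (c.k * c.k) m :=
  .loop (.X * .X) (fun c _ => by
    rw [Polynomial.eval_mul]
    exact Nat.mul_le_mul (k_le_size c) (k_le_size c)) (comp_kmul .k) hF

theorem comp_adj (hu : Comp u) (hv : Comp v) : CompP fun c m => mAdj m c.n (u c m) (v c m) :=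
  .eq (.mem (.add (.add (.add (.const 2) .n) .n) (.add (comp_nmul hu) hv))) (.const 1)

theorem comp_col (hu : Comp u) : Comp fun c m => mCol m (u c m) :=
  .mem (.add (.const 2) hu)

theorem comp_word (hu : Comp u) : Comp fun c m => mWord m c.n (u c m) :=
  .mem (.add (.add (.const 2) .n) hu)

/-- Local variables are used as de Bruijn indices: `Comp.top` is the innermost bound variable, and
`.pop` moves a function under one more binder. -/
theorem comp_deg (hv : Comp v) (hb : Comp b) : Comp fun c m => mDeg m c.n (v c m) (b c m) :=
  comp_countN (.and (comp_adj hv.pop .top) (.eq (comp_col .top) hb.pop))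

theorem comp_aft (hv : Comp v) (hb : Comp b) : Comp fun c m => mAft m c.n (v c m) (b c m) :=
  comp_countN (.and (.lt hv.pop .top) (.eq (comp_word .top) hb.pop))

theorem comp_bef (hv : Comp v) (hb : Comp b) : Comp fun c m => mBef m c.n (v c m) (b c m) :=
  comp_countN (.and (.lt .top hv.pop) (.eq (comp_word .top) hb.pop))

theorem comp_edge (ha : Comp a) (hb : Comp b) : CompP fun c m => mEdge m c.n (a c m) (b c m) :=
  compP_exN (compP_exN (.and (.eq (comp_col Comp.top.pop) ha.pop.pop)
    (.and (.eq (comp_col .top) hb.pop.pop) (comp_adj Comp.top.pop .top))))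

theorem comp_nonedge (ha : Comp a) (hb : Comp b) :
    CompP fun c m => mNonedge m c.n (a c m) (b c m) :=
  compP_exN (compP_exN (.and (.not (.eq Comp.top.pop .top))
    (.and (.eq (comp_col Comp.top.pop) ha.pop.pop)
      (.and (.eq (comp_col .top) hb.pop.pop) (.not (comp_adj Comp.top.pop .top))))))

theorem succ_n_le_size (c : Env) : c.n + 1 ≤ (Polynomial.X + 1 : Polynomial ℕ).eval c.size := by
  simp [Env.size]

theorem comp_fitsAft (ha : Comp a) (hb : Comp b) :
    CompP fun c m => mFitsAft m c.n (a c m) (b c m) :=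
  .all (.X + 1) (fun c _ => succ_n_le_size c) (.add .n (.const 1)) (.eq
    (comp_countN (.and (.eq (comp_col .top) ha.pop.pop)
      (.le Comp.top.pop (comp_deg .top hb.pop.pop))))
    (comp_countN (.and (.eq (comp_word .top) ha.pop.pop)
      (.le Comp.top.pop (comp_aft .top hb.pop.pop)))))

theorem comp_fitsBef (ha : Comp a) (hb : Comp b) :
    CompP fun c m => mFitsBef m c.n (a c m) (b c m) :=
  .all (.X + 1) (fun c _ => succ_n_le_size c) (.add .n (.const 1)) (.eq
    (comp_countN (.and (.eq (comp_col .top) ha.pop.pop)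
      (.le Comp.top.pop (comp_deg .top hb.pop.pop))))
    (comp_countN (.and (.eq (comp_word .top) ha.pop.pop)
      (.le Comp.top.pop (comp_bef .top hb.pop.pop)))))

theorem comp_parallel (ha : Comp a) (hb : Comp b) (hd : Comp d) :
    CompP fun c m => mParallel m c.n (a c m) (b c m) (d c m) :=
  compP_exN (compP_exN (.and (.eq (comp_col Comp.top.pop) ha.pop.pop)
    (.and (.eq (comp_col .top) ha.pop.pop)
      (.and (.lt (comp_deg Comp.top.pop hb.pop.pop) (comp_deg .top hb.pop.pop))
        (.lt (comp_deg Comp.top.pop hd.pop.pop) (comp_deg .top hd.pop.pop))))))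

theorem comp_opposite (ha : Comp a) (hb : Comp b) (hd : Comp d) :
    CompP fun c m => mOpposite m c.n (a c m) (b c m) (d c m) :=
  compP_exN (compP_exN (.and (.eq (comp_col Comp.top.pop) ha.pop.pop)
    (.and (.eq (comp_col .top) ha.pop.pop)
      (.and (.lt (comp_deg Comp.top.pop hb.pop.pop) (comp_deg .top hb.pop.pop))
        (.lt (comp_deg .top hd.pop.pop) (comp_deg Comp.top.pop hd.pop.pop))))))

theorem comp_agree (ha : Comp a) (hb : Comp b) (hd : Comp d) (he : Comp e) :
    CompP fun c m => mAgree m c.n (a c m) (b c m) (d c m) (e c m) :=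
  .or (.and (.eq ha hb) (.eq hd he))
    (.or (.and (.and (comp_edge ha hb) (comp_nonedge ha hb))
      (.and (.not (comp_fitsBef ha hb)) (.and (.eq hd ha) (.eq he ha))))
      (.and (.eq ha hd) (comp_parallel ha hb he)))

theorem comp_differ (ha : Comp a) (hb : Comp b) (hd : Comp d) (he : Comp e) :
    CompP fun c m => mDiffer m c.n (a c m) (b c m) (d c m) (e c m) :=
  .or (.and (.and (comp_edge ha hb) (comp_nonedge ha hb)) (.and (.eq hd hb) (.eq he ha)))
    (.or (.and (.and (comp_edge ha hb) (comp_nonedge ha hb))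
      (.and (.not (comp_fitsAft ha hb)) (.and (.eq hd ha) (.eq he ha))))
      (.and (.eq ha hd) (comp_opposite ha hb he)))

theorem comp_base : Comp fun c _ => base c.n c.k :=
  .add (.add (.add (.add (.const 2) .n) .n) (comp_nmul .n)) (comp_kmul .k)

theorem comp_base' : Comp fun c _ => base' c.n c.k :=
  .add comp_base (comp_kmul .k)

theorem comp_dec (ha : Comp a) (hb : Comp b) :
    CompP fun c m => mDec m c.n c.k (a c m) (b c m) :=
  .eq (.mem (.add comp_base' (.add (comp_kmul ha) hb))) (.const 1)

theorem comp_LG (hu : Comp u) (hv : Comp v) : CompP fun c m => mLG m c.n c.k (u c m) (v c m) :=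
  .or (.and (.lt hu hv) (comp_dec (comp_word hu) (comp_word hv)))
    (.and (.lt hv hu) (comp_dec (comp_word hv) (comp_word hu)))

theorem comp_degLG (hv : Comp v) (hb : Comp b) :
    Comp fun c m => mDegLG m c.n c.k (v c m) (b c m) :=
  comp_countN (.and (comp_LG hv.pop .top) (.eq (comp_word .top) hb.pop))

theorem comp_check : CompP fun c m => mCheck m c.n c.k :=
  .and
    (compP_allN (compP_allN (.imp (.not (.eq Comp.top.pop .top))
      (.iff (comp_adj Comp.top.pop .top) (.lt
        (comp_countN (.and (.eq (comp_col .top) (comp_col Comp.top.pop))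
          (.lt (comp_deg Comp.top.pop (comp_col Comp.top.pop.pop))
            (comp_deg .top (comp_col Comp.top.pop.pop)))))
        (comp_deg Comp.top.pop (comp_col .top)))))))
    (compP_allN (.le
      (comp_countN (.and (.eq (comp_col .top) (comp_col Comp.top.pop))
        (compP_allK (.eq (comp_deg Comp.top.pop .top) (comp_deg Comp.top.pop.pop .top)))))
      (comp_countN (.and (.eq (comp_word .top) (comp_col Comp.top.pop))
        (compP_allK (.eq (comp_degLG Comp.top.pop .top) (comp_deg Comp.top.pop.pop .top)))))))

theorem comp_choice (ha : Comp a) (hb : Comp b) :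
    CompP fun c m => mChoice m c.n c.k (a c m) (b c m) :=
  .and (comp_edge ha hb) (.or (.not (comp_nonedge ha hb)) (.iff
    (.lt (.mem (.add comp_base (.add (comp_kmul ha) hb))) (comp_kmul .k))
    (.lt (.mem (.add comp_base (.add (comp_kmul ha) ha))) (comp_kmul .k))))

theorem comp_quo (hu : Comp u) : Comp fun c m => quo c.k (u c m) :=
  .count .X (fun c _ => k_le_size c) .k
    (.le (comp_kmul (.add .top (.const 1))) hu.pop)

theorem comp_rem (hu : Comp u) : Comp fun c m => rem c.k (u c m) :=
  hu.sub (comp_kmul (comp_quo hu))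

theorem comp_neg (hu : Comp u) : Comp fun c m => opp c.k (u c m) :=
  .sub (.sub (.add (comp_kmul .k) (comp_kmul .k)) (.const 1)) hu

theorem comp_ite [∀ c m, Decidable (p c m)] (hp : CompP p) (hu : Comp u) (hv : Comp v) :
    Comp fun c m => if p c m then u c m else v c m :=
  ((Comp.mul 1 (fun c m => by unfold ind; split_ifs <;> simp) hp hu).add
    (Comp.mul 1 (fun c m => by unfold ind; split_ifs <;> simp) hp.not hv)).of_eq fun c m => by
      by_cases h : p c m <;> simp [h, ind]

theorem comp_replace (ha : Comp a) (hb : Comp b) (hd : Comp d) :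
    Comp fun c m => replace c.k (a c m) (b c m) (d c m) :=
  comp_ite (.eq hd ha) hb (comp_ite (.eq hd (comp_neg ha)) (comp_neg hb) hd)

/-- The two representatives are bound to local variables before the loop, since the loop overwrites
the cells they may have been read from. -/
theorem compS_merge (ha : Comp a) (hb : Comp b) :
    CompS fun c m => merge c.n c.k (a c m) (b c m) m :=
  CompS.bind ha (.bind hb.pop (compS_loopKK (.store (.add comp_base .top)
    (comp_replace Comp.top.pop.pop Comp.top.pop (.mem (.add comp_base .top))))))

theorem compS_agreeStep (hu : Comp u) (hv : Comp v) :
    CompS fun c m => agreeStep c.n c.k (u c m) (v c m) m :=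
  .ite (comp_agree (comp_quo hu) (comp_rem hu) (comp_quo hv) (comp_rem hv))
    (compS_merge (.mem (.add comp_base hu)) (.mem (.add comp_base hv))) .skip

theorem compS_differStep (hu : Comp u) (hv : Comp v) :
    CompS fun c m => differStep c.n c.k (u c m) (v c m) m :=
  .ite (comp_differ (comp_quo hu) (comp_rem hu) (comp_quo hv) (comp_rem hv))
    (compS_merge (.mem (.add comp_base hu)) (comp_neg (.mem (.add comp_base hv)))) .skip

theorem compS_start : CompS fun c m => start c.n c.k m :=
  compS_loopKK (.store (.add comp_base .top) .top)

theorem compS_propagate : CompS fun c m => propagate c.n c.k m :=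
  compS_loopKK (compS_loopKK (.seq (compS_agreeStep Comp.top.pop .top)
    (compS_differStep Comp.top.pop .top)))

theorem compS_decode : CompS fun c m => decode c.n c.k m :=
  compS_loopKK (.store (.add comp_base' .top) (comp_choice (comp_quo .top) (comp_rem .top)))

/-- The test is evaluated and kept in a local variable first, because copying the decoder to the
front may destroy the input. -/
theorem compS_output : CompS fun c m => output c.n c.k m :=
  CompS.bind comp_check (.seq
    (compS_loopKK (.store (.add (.const 1) .top) (.mem (.add comp_base' .top))))
    (.store (.const 0) .top))

theorem compS_solve : CompS fun c m => solve c.n c.k m :=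
  CompS.seq (F := fun c m => decode c.n c.k (propagate c.n c.k (start c.n c.k m)))
    (.seq (F := fun c m => propagate c.n c.k (start c.n c.k m))
      (.seq compS_start compS_propagate) compS_decode) compS_output

end Comp

/-! ### Correctness -/

theorem count_eq_ncard (n : ℕ) (p : ℕ → Prop) : count n p = {i : Fin n | p i}.ncard := by
  classical
  rw [count, Finset.sum_range, Set.ncard_eq_toFinset_card', Set.toFinset_ofPred,
    Finset.card_filter]
  simp only [ind]

theorem exists_lt_iff {n : ℕ} {p : ℕ → Prop} : (∃ i < n, p i) ↔ ∃ i : Fin n, p i :=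
  ⟨fun ⟨i, h, hp⟩ => ⟨⟨i, h⟩, hp⟩, fun ⟨i, hp⟩ => ⟨i, i.2, hp⟩⟩

theorem forall_lt_iff {n : ℕ} {p : ℕ → Prop} : (∀ i < n, p i) ↔ ∀ i : Fin n, p i :=
  ⟨fun h i => h i i.2, fun h i hi => h ⟨i, hi⟩⟩

/-- The memory `m` holds the graph `G`, the coloring `col` and the word `W`. -/
structure Encodes {n k : ℕ} (m : ℕ → ℕ) (G : Fin n → Fin n → Prop) (col : Fin n → Fin k)
    (W : Fin n → Fin k) : Prop where
  adj : ∀ u v : Fin n, mAdj m n u v ↔ G u v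
  col : ∀ v : Fin n, mCol m v = col v
  word : ∀ p : Fin n, mWord m n p = W p

namespace Encodes

variable {n k : ℕ} {m : ℕ → ℕ} {G : Fin n → Fin n → Prop} {col W : Fin n → Fin k}

theorem congr (h : Encodes m G col W) {m' : ℕ → ℕ} (hm : ∀ i < base n k, m' i = m i) :
    Encodes m' G col W := by
  refine ⟨fun u v => ?_, fun v => ?_, fun p => ?_⟩
  · rw [← h.adj, mAdj, mAdj, hm]
    have h1 : n * (u + 1) ≤ n * n := Nat.mul_le_mul le_rfl u.2
    have h2 := v.2
    rw [mul_add, mul_one] at h1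
    unfold base
    omega
  · rw [← h.col, mCol, mCol, hm]
    have := v.2
    unfold base
    omega
  · rw [← h.word, mWord, mWord, hm]
    have := p.2
    unfold base
    omega

theorem deg (h : Encodes m G col W) (v : Fin n) (b : Fin k) :
    mDeg m n v b = DecoderRetrieval.deg G col v b := by
  simp only [mDeg, DecoderRetrieval.deg, count_eq_ncard, h.adj, h.col, Fin.val_inj]

theorem aft (h : Encodes m G col W) (v : Fin n) (b : Fin k) :
    mAft m n v b = DecoderRetrieval.aft W v b := by
  simp only [mAft, DecoderRetrieval.aft, count_eq_ncard, h.word, Fin.val_inj, Fin.val_fin_lt]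

theorem bef (h : Encodes m G col W) (v : Fin n) (b : Fin k) :
    mBef m n v b = DecoderRetrieval.bef W v b := by
  simp only [mBef, DecoderRetrieval.bef, count_eq_ncard, h.word, Fin.val_inj, Fin.val_fin_lt]

theorem edge (h : Encodes m G col W) (a b : Fin k) :
    mEdge m n a b ↔ DecoderRetrieval.edge G col a b := by
  simp only [mEdge, DecoderRetrieval.edge, exists_lt_iff, h.adj, h.col, Fin.val_inj]

theorem nonedge (h : Encodes m G col W) (a b : Fin k) :
    mNonedge m n a b ↔ DecoderRetrieval.nonedge G col a b := by
  simp only [mNonedge, DecoderRetrieval.nonedge, exists_lt_iff, h.adj, h.col, Fin.val_inj, ne_eq]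

theorem ncard_le (s : Set (Fin n)) : s.ncard ≤ n := by
  simpa using Set.ncard_le_card s

/-- Thresholds above `n` give empty sets on both sides, so the machine need not test them. -/
theorem forall_le_iff {f g : Fin n → ℕ} (hf : ∀ i, f i ≤ n) (hg : ∀ i, g i ≤ n)
    {p q : Fin n → Prop} :
    (∀ d < n + 1, {i | p i ∧ d ≤ f i}.ncard = {i | q i ∧ d ≤ g i}.ncard) ↔
      ∀ d, {i | p i ∧ d ≤ f i}.ncard = {i | q i ∧ d ≤ g i}.ncard := by
  refine ⟨fun h d => ?_, fun h d _ => h d⟩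
  by_cases hd : d < n + 1
  · exact h d hd
  · have h1 : {i | p i ∧ d ≤ f i} = ∅ := by
      ext i
      have := hf i
      simp only [Set.mem_ofPred_eq, Set.mem_empty_iff_false, iff_false]
      omega
    have h2 : {i | q i ∧ d ≤ g i} = ∅ := by
      ext i
      have := hg i
      simp only [Set.mem_ofPred_eq, Set.mem_empty_iff_false, iff_false]
      omega
    rw [h1, h2]

theorem fitsAft (h : Encodes m G col W) (a b : Fin k) :
    mFitsAft m n a b ↔ Fits G col W (DecoderRetrieval.aft W) a b := by
  simp only [mFitsAft, Fits, count_eq_ncard, h.deg, h.aft, h.word, h.col, Fin.val_inj]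
  exact forall_le_iff (fun _ => ncard_le _) fun _ => ncard_le _

theorem fitsBef (h : Encodes m G col W) (a b : Fin k) :
    mFitsBef m n a b ↔ Fits G col W (DecoderRetrieval.bef W) a b := by
  simp only [mFitsBef, Fits, count_eq_ncard, h.deg, h.bef, h.word, h.col, Fin.val_inj]
  exact forall_le_iff (fun _ => ncard_le _) fun _ => ncard_le _

theorem parallel (h : Encodes m G col W) (a b d : Fin k) :
    mParallel m n a b d ↔ Parallel G col a b d := by
  simp only [mParallel, Parallel, exists_lt_iff, h.deg, h.col, Fin.val_inj]

theorem opposite (h : Encodes m G col W) (a b d : Fin k) :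
    mOpposite m n a b d ↔ Opposite G col a b d := by
  simp only [mOpposite, Opposite, exists_lt_iff, h.deg, h.col, Fin.val_inj]

theorem agree (h : Encodes m G col W) (a b c d : Fin k) :
    mAgree m n a b c d ↔ MustAgree G col W a b c d := by
  simp only [mAgree, MustAgree, active, h.edge, h.nonedge, h.fitsBef, h.parallel, Fin.val_inj]

theorem differ (h : Encodes m G col W) (a b c d : Fin k) :
    mDiffer m n a b c d ↔ MustDiffer G col W a b c d := by
  simp only [mDiffer, MustDiffer, active, h.edge, h.nonedge, h.fitsAft, h.opposite, Fin.val_inj]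

theorem choice (h : Encodes m G col W) (a b : Fin k) :
    mChoice m n k a b ↔ choiceDecoder G col (fun a b =>
      m (base n k + (k * a + b)) < k * k ↔ m (base n k + (k * a + a)) < k * k) a b := by
  simp only [mChoice, choiceDecoder, h.edge, h.nonedge]

theorem degLG (h : Encodes m G col W) (p : Fin n) (b : Fin k) :
    mDegLG m n k p b = DecoderRetrieval.deg (LG (fun a b : Fin k => mDec m n k a b) W) W p b := by
  simp only [mDegLG, mLG, LG, DecoderRetrieval.deg, count_eq_ncard, h.word, Fin.val_inj,
    Fin.val_fin_lt]

/-- The test is exact for whatever decoder the array contains, so soundness does not depend on the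
propagation. -/
theorem check (h : Encodes m G col W) (hirr : ∀ v, ¬ G v v) :
    mCheck m n k ↔ Sol G col W fun a b : Fin k => mDec m n k a b := by
  rw [sol_iff rfl hirr]
  simp only [mCheck, DegDetermined, forall_lt_iff, count_eq_ncard, h.adj, h.col, h.word, h.deg,
    h.degLG, Fin.val_inj, ne_eq]

end Encodes

/-! #### Loops -/

section Iter

variable {M : Type*} {F : ℕ → M → M} {N : ℕ}

theorem iter_induction {I : M → Prop} (hF : ∀ i < N, ∀ m, I m → I (F i m)) {m : M} (hm : I m) :
    I (iter F N m) := by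
  induction N with
  | zero => exact hm
  | succ N ih => exact hF N (by omega) _ (ih fun i hi => hF i (by omega))

/-- The rounds of a loop that preserves the invariant `I` and makes progress with respect to `R`. -/
theorem iter_progress {I : M → Prop} {R : M → M → Prop} (hrefl : ∀ m, R m m)
    (htrans : ∀ m₁ m₂ m₃, R m₁ m₂ → R m₂ m₃ → R m₁ m₃)
    (hF : ∀ i < N, ∀ m, I m → I (F i m) ∧ R m (F i m)) {m : M} (hm : I m) :
    I (iter F N m) ∧ R m (iter F N m) ∧ ∀ i < N, ∃ m', I m' ∧ R (F i m') (iter F N m) := by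
  induction N with
  | zero => exact ⟨hm, hrefl m, fun i hi => (Nat.not_lt_zero i hi).elim⟩
  | succ N ih =>
    obtain ⟨h1, h2, h3⟩ := ih fun i hi => hF i (by omega)
    obtain ⟨h4, h5⟩ := hF N (by omega) _ h1
    refine ⟨h4, htrans _ _ _ h2 h5, fun i hi => ?_⟩
    rcases Nat.lt_succ_iff_lt_or_eq.1 hi with hi | rfl
    · obtain ⟨m', hm', hR⟩ := h3 i hi
      exact ⟨m', hm', htrans _ _ _ hR h5⟩
    · exact ⟨_, h1, hrefl _⟩

/-- A loop that fills the cells `a`, …, `a + N - 1`. -/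
theorem iter_update {a N : ℕ} {h : ℕ → (ℕ → ℕ) → ℕ} {g m : ℕ → ℕ}
    (hg : ∀ x < N, ∀ m' : ℕ → ℕ, (∀ y, y < a ∨ a + x ≤ y → m' y = m y) → h x m' = g x) :
    (∀ y, y < a ∨ a + N ≤ y → iter (fun x m => Function.update m (a + x) (h x m)) N m y = m y) ∧
      ∀ x < N, iter (fun x m => Function.update m (a + x) (h x m)) N m (a + x) = g x := by
  induction N with
  | zero => exact ⟨fun _ _ => rfl, fun x hx => (Nat.not_lt_zero x hx).elim⟩
  | succ N ih =>
    obtain ⟨h1, h2⟩ := ih fun x hx => hg x (by omega)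
    constructor
    · intro y hy
      rw [iter, Function.update_of_ne (by omega), h1 y (by omega)]
    · intro x hx
      rw [iter]
      rcases Nat.lt_succ_iff_lt_or_eq.1 hx with hx | rfl
      · rw [Function.update_of_ne (by omega), h2 x hx]
      · rw [Function.update_self, hg x (by omega) _ h1]

end Iter

/-! #### Signed representatives -/

theorem quo_eq {k a b : ℕ} (ha : a < k) (hb : b < k) : quo k (k * a + b) = a := by
  have : ∀ i < k, (k * (i + 1) ≤ k * a + b ↔ i < a) := fun i _ => by
    constructor
    · intro h
      by_contra hc
      have := Nat.mul_le_mul (le_refl k) (show a + 1 ≤ i + 1 by omega)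
      rw [mul_add k a 1] at this
      omega
    · intro h
      have := Nat.mul_le_mul (le_refl k) (show i + 1 ≤ a by omega)
      omega
  have h1 : quo k (k * a + b) = ∑ i ∈ Finset.range k, if i < a then 1 else 0 := by
    unfold quo count
    refine Finset.sum_congr rfl fun i hi => ?_
    simp only [ind, this i (Finset.mem_range.1 hi)]
  rw [h1, ← Finset.card_filter]
  have : Finset.filter (· < a) (Finset.range k) = Finset.range a := by
    ext i
    simp only [Finset.mem_filter, Finset.mem_range]
    omega
  rw [this, Finset.card_range]

theorem rem_eq {k a b : ℕ} (ha : a < k) (hb : b < k) : rem k (k * a + b) = b := by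
  rw [rem, quo_eq ha hb]
  omega

theorem index_lt {k : ℕ} (a b : Fin k) : k * a + b < k * k := by
  have h1 := Nat.mul_le_mul (le_refl k) (show (a : ℕ) + 1 ≤ k from a.2)
  have h2 := b.2
  rw [mul_add] at h1
  omega

theorem exists_index {k x : ℕ} (hx : x < k * k) : ∃ a b : Fin k, x = k * a + b := by
  have hk : 0 < k := Nat.pos_of_ne_zero (by rintro rfl; simp at hx)
  exact ⟨⟨x / k, Nat.div_lt_of_lt_mul hx⟩, ⟨x % k, Nat.mod_lt _ hk⟩, (Nat.div_add_mod x k).symm⟩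

theorem merge_spec (n k A C : ℕ) (m : ℕ → ℕ) :
    (∀ y, y < base n k → merge n k A C m y = m y) ∧
      ∀ x < k * k, merge n k A C m (base n k + x) = replace k A C (m (base n k + x)) := by
  obtain ⟨h1, h2⟩ := iter_update (a := base n k) (N := k * k) (m := m)
    (h := fun x m => replace k A C (m (base n k + x)))
    (g := fun x => replace k A C (m (base n k + x))) fun x _ m' hm' => by
      -- Round `x` reads only cell `base n k + x`, which no earlier round has written.
      simp only [hm' _ (.inr le_rfl)]
  exact ⟨fun y hy => h1 y (.inl hy), h2⟩

theorem agreeStep_of_lt {n k u v : ℕ} (m : ℕ → ℕ) {y : ℕ} (hy : y < base n k) :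
    agreeStep n k u v m y = m y := by
  unfold agreeStep
  split_ifs
  · exact (merge_spec ..).1 y hy
  · rfl

theorem differStep_of_lt {n k u v : ℕ} (m : ℕ → ℕ) {y : ℕ} (hy : y < base n k) :
    differStep n k u v m y = m y := by
  unfold differStep
  split_ifs
  · exact (merge_spec ..).1 y hy
  · rfl

theorem propagate_of_lt {n k : ℕ} (m : ℕ → ℕ) {y : ℕ} (hy : y < base n k) :
    propagate n k m y = m y :=
  iter_induction (I := fun m' : ℕ → ℕ => m' y = m y) (fun _ _ m' hm' =>
    iter_induction (I := fun m' : ℕ → ℕ => m' y = m y) (fun _ _ m' hm' => by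
      rw [differStep_of_lt _ hy, agreeStep_of_lt _ hy, hm']) hm') rfl

/-- The values in the array agree with the truth values `s` under an assignment `τ` of truth values
to the signed representatives. -/
def Represents (n k : ℕ) (s τ : ℕ → Prop) (m : ℕ → ℕ) : Prop :=
  ∀ x < k * k, m (base n k + x) < k * k + k * k ∧ (τ (m (base n k + x)) ↔ s x)

/-- Whatever is known in `m` about equal and opposite representatives also holds in `m'`. -/
def Refines (n k : ℕ) (m m' : ℕ → ℕ) : Prop :=
  ∀ u < k * k, ∀ v < k * k,
    (m (base n k + u) = m (base n k + v) → m' (base n k + u) = m' (base n k + v)) ∧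
    (m (base n k + u) = opp k (m (base n k + v)) →
      m' (base n k + u) = opp k (m' (base n k + v)))

theorem Refines.refl {n k : ℕ} (m : ℕ → ℕ) : Refines n k m m := fun _ _ _ _ => ⟨id, id⟩

theorem Refines.trans {n k : ℕ} {m₁ m₂ m₃ : ℕ → ℕ} (h : Refines n k m₁ m₂)
    (h' : Refines n k m₂ m₃) : Refines n k m₁ m₃ := fun u hu v hv =>
  ⟨fun e => (h' u hu v hv).1 ((h u hu v hv).1 e), fun e => (h' u hu v hv).2 ((h u hu v hv).2 e)⟩

/-! ### Merging signed representatives -/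

section Merge

variable {n k A C : ℕ} {s τ : ℕ → Prop} {m : ℕ → ℕ}

/-- A value and its negative add up to the odd number `2 * k * k - 1`, so no value is its own
negative and the two replacement rules cannot collide. -/
theorem replace_opp (hA : A < k * k + k * k) (hC : C < k * k + k * k) {y : ℕ}
    (hy : y < k * k + k * k) : replace k A C (opp k y) = opp k (replace k A C y) := by
  unfold replace opp
  generalize k * k = K at *
  split_ifs <;> omega

theorem replace_self : replace k A C A = C := by simp [replace]

/-- The replaced value has the same truth value under `τ`. Known equalities survive since every cell
undergoes the same map, known oppositions since this map commutes with `opp`. -/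
theorem merge_represents (hτ : ∀ c < k * k + k * k, (τ (opp k c) ↔ ¬ τ c))
    (hA : A < k * k + k * k) (hC : C < k * k + k * k) (hAC : τ A ↔ τ C)
    (h : Represents n k s τ m) :
    Represents n k s τ (merge n k A C m) ∧ Refines n k m (merge n k A C m) := by
  have hs := (merge_spec n k A C m).2
  constructor
  · intro x hx
    obtain ⟨h1, h2⟩ := h x hx
    rw [hs x hx, ← h2]
    unfold replace
    split_ifs with e e'
    · exact ⟨hC, by rw [e, hAC]⟩
    · refine ⟨by unfold opp; omega, ?_⟩
      rw [e']
      exact (hτ C hC).trans ((not_congr hAC).symm.trans (hτ A hA).symm)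
    · exact ⟨h1, Iff.rfl⟩
  · intro u hu v hv
    rw [hs u hu, hs v hv]
    exact ⟨fun e => by rw [e], fun e => by rw [e, replace_opp hA hC (h v hv).1]⟩

/-- Afterwards the representative `C` stands for `A` and for `C`. -/
theorem replace_target (hτ : ∀ c < k * k + k * k, (τ (opp k c) ↔ ¬ τ c))
    (hA : A < k * k + k * k) (hAC : τ A ↔ τ C) : replace k A C C = C := by
  unfold replace
  split_ifs with e e'
  · rfl
  -- Here `C` would be the negative of `A`, although both have the same truth value.
  · have := hτ A hA
    rw [← e'] at this
    tauto
  · rfl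

end Merge

/-! ### Propagation of the conditions -/

section Propagate

variable {n k : ℕ} {G : Fin n → Fin n → Prop} {col W : Fin n → Fin k} {s τ : ℕ → Prop}

structure Invariant (G : Fin n → Fin n → Prop) (col W : Fin n → Fin k) (s τ : ℕ → Prop)
    (m : ℕ → ℕ) : Prop where
  encodes : Encodes m G col W
  represents : Represents n k s τ m

variable {x : Fin k → Fin k → Prop} {m : ℕ → ℕ}

theorem agreeStep_spec (hτ : ∀ c < k * k + k * k, (τ (opp k c) ↔ ¬ τ c))
    (hs : ∀ a b : Fin k, s (k * a + b) ↔ x a b) (hx : Consistent G col W x)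
    (a b c d : Fin k) (h : Invariant G col W s τ m) :
    Invariant G col W s τ (agreeStep n k (k * a + b) (k * c + d) m) ∧
    Refines n k m (agreeStep n k (k * a + b) (k * c + d) m) ∧
    (MustAgree G col W a b c d →
      agreeStep n k (k * a + b) (k * c + d) m (base n k + (k * a + b)) =
        agreeStep n k (k * a + b) (k * c + d) m (base n k + (k * c + d))) := by
  have hE := h.encodes.congr (m' := agreeStep n k (k * a + b) (k * c + d) m)
    fun i hi => agreeStep_of_lt m hi
  suffices H : Represents n k s τ (agreeStep n k (k * a + b) (k * c + d) m) ∧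
      Refines n k m (agreeStep n k (k * a + b) (k * c + d) m) ∧ _ from ⟨⟨hE, H.1⟩, H.2⟩
  unfold agreeStep
  rw [quo_eq a.2 b.2, quo_eq c.2 d.2, rem_eq a.2 b.2, rem_eq c.2 d.2]
  rw [h.encodes.agree]
  split_ifs with hm
  · obtain ⟨h1, h2⟩ := h.represents _ (index_lt a b)
    obtain ⟨h3, h4⟩ := h.represents _ (index_lt c d)
    have hAC : τ (m (base n k + (k * a + b))) ↔ τ (m (base n k + (k * c + d))) := by
      rw [h2, h4, hs, hs]
      exact (hx a b c d).1 hm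
    obtain ⟨h5, h6⟩ := merge_represents hτ h1 h3 hAC h.represents
    refine ⟨h5, h6, fun _ => ?_⟩
    rw [(merge_spec ..).2 _ (index_lt a b), (merge_spec ..).2 _ (index_lt c d), replace_self,
      replace_target hτ h1 hAC]
  · exact ⟨h.represents, .refl m, fun h => (hm h).elim⟩

theorem differStep_spec (hτ : ∀ c < k * k + k * k, (τ (opp k c) ↔ ¬ τ c))
    (hs : ∀ a b : Fin k, s (k * a + b) ↔ x a b) (hx : Consistent G col W x)
    (a b c d : Fin k) (h : Invariant G col W s τ m) :
    Invariant G col W s τ (differStep n k (k * a + b) (k * c + d) m) ∧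
    Refines n k m (differStep n k (k * a + b) (k * c + d) m) ∧
    (MustDiffer G col W a b c d →
      differStep n k (k * a + b) (k * c + d) m (base n k + (k * a + b)) =
        opp k (differStep n k (k * a + b) (k * c + d) m (base n k + (k * c + d)))) := by
  have hE := h.encodes.congr (m' := differStep n k (k * a + b) (k * c + d) m)
    fun i hi => differStep_of_lt m hi
  suffices H : Represents n k s τ (differStep n k (k * a + b) (k * c + d) m) ∧
      Refines n k m (differStep n k (k * a + b) (k * c + d) m) ∧ _ from ⟨⟨hE, H.1⟩, H.2⟩
  unfold differStep
  rw [quo_eq a.2 b.2, quo_eq c.2 d.2, rem_eq a.2 b.2, rem_eq c.2 d.2]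
  rw [h.encodes.differ]
  split_ifs with hm
  · obtain ⟨h1, h2⟩ := h.represents _ (index_lt a b)
    obtain ⟨h3, h4⟩ := h.represents _ (index_lt c d)
    have h3' : opp k (m (base n k + (k * c + d))) < k * k + k * k := by
      unfold opp
      omega
    have hAC : τ (m (base n k + (k * a + b))) ↔ τ (opp k (m (base n k + (k * c + d)))) := by
      rw [hτ _ h3, h2, h4, hs, hs]
      exact (hx a b c d).2 hm
    obtain ⟨h5, h6⟩ := merge_represents hτ h1 h3' hAC h.represents
    refine ⟨h5, h6, fun _ => ?_⟩
    rw [(merge_spec ..).2 _ (index_lt a b), (merge_spec ..).2 _ (index_lt c d), replace_self,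
      ← replace_opp h1 h3' h3, replace_target hτ h1 hAC]
  · exact ⟨h.represents, .refl m, fun h => (hm h).elim⟩

/-- After the propagation all requirements are reflected in the array. -/
theorem propagate_spec (hτ : ∀ c < k * k + k * k, (τ (opp k c) ↔ ¬ τ c))
    (hs : ∀ a b : Fin k, s (k * a + b) ↔ x a b) (hx : Consistent G col W x)
    (h : Invariant G col W s τ m) :
    Invariant G col W s τ (propagate n k m) ∧ ∀ a b c d : Fin k,
      (MustAgree G col W a b c d → propagate n k m (base n k + (k * a + b)) =
        propagate n k m (base n k + (k * c + d))) ∧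
      (MustDiffer G col W a b c d → propagate n k m (base n k + (k * a + b)) =
        opp k (propagate n k m (base n k + (k * c + d)))) := by
  have step : ∀ u < k * k, ∀ v < k * k, ∀ m, Invariant G col W s τ m →
      Invariant G col W s τ (differStep n k u v (agreeStep n k u v m)) ∧
      Refines n k m (differStep n k u v (agreeStep n k u v m)) := by
    intro u hu v hv m h
    obtain ⟨a, b, rfl⟩ := exists_index hu
    obtain ⟨c, d, rfl⟩ := exists_index hv
    obtain ⟨h1, h2, -⟩ := agreeStep_spec hτ hs hx a b c d h
    obtain ⟨h3, h4, -⟩ := differStep_spec hτ hs hx a b c d h1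
    exact ⟨h3, h2.trans h4⟩
  have inner := fun u (hu : u < k * k) m (h : Invariant G col W s τ m) =>
    iter_progress (R := Refines n k) .refl (fun _ _ _ => .trans) (step u hu) h
  obtain ⟨h1, -, h3⟩ := iter_progress (R := Refines n k) .refl (fun _ _ _ => .trans)
    (fun u hu m h => ⟨(inner u hu m h).1, (inner u hu m h).2.1⟩) h
  refine ⟨h1, fun a b c d => ?_⟩
  -- Go back to the state just before the round for `ab` and `cd`. What that round establishes is
  -- never lost, because all later rounds only refine.
  obtain ⟨m', hm', hR⟩ := h3 _ (index_lt a b)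
  obtain ⟨m'', hm'', hR'⟩ := (inner _ (index_lt a b) m' hm').2.2 _ (index_lt c d)
  have hR'' := (hR'.trans hR) _ (index_lt a b) _ (index_lt c d)
  obtain ⟨h4, -, h5⟩ := agreeStep_spec hτ hs hx a b c d hm''
  obtain ⟨h6, h7, h8⟩ := differStep_spec hτ hs hx a b c d h4
  exact ⟨fun h => hR''.1 ((h7 _ (index_lt a b) _ (index_lt c d)).1 (h5 h)),
    fun h => hR''.2 (h8 h)⟩

end Propagate

/-! ### Correctness of the whole algorithm -/

section Solve

variable {n k : ℕ} {G : Fin n → Fin n → Prop} {col W : Fin n → Fin k} {m : ℕ → ℕ}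

theorem start_spec (n k : ℕ) (m : ℕ → ℕ) :
    (∀ y, y < base n k → start n k m y = m y) ∧
      ∀ x < k * k, start n k m (base n k + x) = x := by
  obtain ⟨h1, h2⟩ := iter_update (a := base n k) (N := k * k) (m := m) (h := fun x _ => x)
    (g := fun x => x) fun _ _ _ _ => rfl
  exact ⟨fun y hy => h1 y (.inl hy), h2⟩

/-- The choice that can be read from the signed representatives: the sign of the representative
of `ab` is compared with the sign of the representative of true. -/
def signChoice (n : ℕ) {k : ℕ} (m : ℕ → ℕ) (a b : Fin k) : Prop :=
  m (base n k + (k * a + b)) < k * k ↔ m (base n k + (k * a + a)) < k * k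

theorem decode_spec (h : Encodes m G col W) :
    (∀ y, y < base' n k → decode n k m y = m y) ∧ ∀ a b : Fin k,
      (mDec (decode n k m) n k a b ↔ choiceDecoder G col (signChoice n m) a b) := by
  have hlt : base n k + k * k ≤ base' n k := le_rfl
  obtain ⟨h1, h2⟩ := iter_update (a := base' n k) (N := k * k) (m := m)
    (h := fun x m => ind (mChoice m n k (quo k x) (rem k x)))
    (g := fun x => ind (mChoice m n k (quo k x) (rem k x))) fun x hx m' hm' => by
      obtain ⟨a, b, rfl⟩ := exists_index hx
      have h' : Encodes m' G col W := h.congr fun i hi => hm' i (by omega)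
      simp only [quo_eq a.2 b.2, rem_eq a.2 b.2, h.choice, h'.choice]
      have := index_lt a b
      have := index_lt a a
      -- The choice reads only cells below `base'`, which this loop does not touch.
      rw [choiceDecoder, choiceDecoder, hm' _ (by omega), hm' _ (by omega)]
  refine ⟨fun y hy => h1 y (.inl hy), fun a b => ?_⟩
  have := h2 _ (index_lt a b)
  rw [quo_eq a.2 b.2, rem_eq a.2 b.2] at this
  rw [mDec, decode, this]
  rw [show choiceDecoder G col (signChoice n m) a b ↔ mChoice m n k a b from (h.choice a b).symm]
  by_cases hc : mChoice m n k a b <;> simp [ind, hc]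

theorem output_spec (n k : ℕ) (m : ℕ → ℕ) :
    output n k m 0 = ind (mCheck m n k) ∧
      ∀ x < k * k, output n k m (1 + x) = m (base' n k + x) := by
  obtain ⟨-, h2⟩ := iter_update (a := 1) (N := k * k) (m := m)
    (h := fun x m => m (base' n k + x)) (g := fun x => m (base' n k + x)) fun x hx m' hm' =>
      -- The copied cells lie beyond all target cells `1`, …, `k * k`, so no source is overwritten.
      hm' _ (.inr (by unfold base' base; omega))
  refine ⟨by simp [output], fun x hx => ?_⟩
  rw [output, Function.update_of_ne (by omega), h2 x hx]

theorem signChoice_self (n : ℕ) (m : ℕ → ℕ) (a : Fin k) : signChoice n m a a := Iff.rfl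

/-- If a solution exists, then the propagation leads to a consistent choice. -/
theorem consistent_signChoice {D : Fin k → Fin k → Prop} (h : Encodes m G col W)
    (hD : Sol G col W D) :
    Consistent G col W (signChoice n (propagate n k (start n k m))) := by
  have hx := hD.consistent
  set x : Fin k → Fin k → Prop := fun a b => a = b ∨ D a b
  let s : ℕ → Prop := fun i => ∃ a b : Fin k, i = k * a + b ∧ x a b
  have hs : ∀ a b : Fin k, s (k * a + b) ↔ x a b := by
    refine fun a b => ⟨?_, fun h => ⟨a, b, rfl, h⟩⟩
    rintro ⟨a', b', e, h⟩
    have h1 : a = a' := Fin.ext (by rw [← quo_eq a.2 b.2, e, quo_eq a'.2 b'.2])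
    have h2 : b = b' := Fin.ext (by rw [← rem_eq a.2 b.2, e, rem_eq a'.2 b'.2])
    rwa [h1, h2]
  -- Representatives below `k * k` are positive literals, the others negated ones; `τ` evaluates
  -- them under the known solution, which shows that merging never identifies a literal with its
  -- negation.
  let τ : ℕ → Prop := fun c => if c < k * k then s c else ¬ s (opp k c)
  have hτ : ∀ c < k * k + k * k, (τ (opp k c) ↔ ¬ τ c) := by
    intro c hc
    have e : opp k (opp k c) = c := by unfold opp; omega
    by_cases hck : c < k * k
    · have : ¬ opp k c < k * k := by unfold opp; omega
      simp [τ, hck, this, e]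
    · have : opp k c < k * k := by unfold opp; omega
      simp [τ, hck, this]
  obtain ⟨h1, h2⟩ := start_spec n k m
  obtain ⟨hI, hP⟩ := propagate_spec hτ hs hx (m := start n k m)
    ⟨h.congr h1, fun i hi => by
      rw [h2 i hi]
      exact ⟨by omega, by simp [τ, hi]⟩⟩
  set m' := propagate n k (start n k m)
  -- All diagonal words end with one common representative, so comparing signs with `aa` or with
  -- `cc` is the same.
  have hdiag : ∀ a c : Fin k, m' (base n k + (k * a + a)) = m' (base n k + (k * c + c)) :=
    fun a c => (hP a a c c).1 (.inl ⟨rfl, rfl⟩)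
  intro a b c d
  refine ⟨fun hm => ?_, fun hm => ?_⟩
  · rw [signChoice, signChoice, (hP a b c d).1 hm, hdiag a c]
  · rw [signChoice, signChoice, (hP a b c d).2 hm, hdiag a c]
    have hlt := (hI.represents _ (index_lt c d)).1
    have : opp k (m' (base n k + (k * c + d))) < k * k ↔
        ¬ m' (base n k + (k * c + d)) < k * k := by
      unfold opp
      omega
    rw [this]
    tauto

/-- The decoder found by the algorithm. -/
def foundDecoder (n k : ℕ) (m : ℕ → ℕ) (a b : Fin k) : Prop :=
  solve n k m (1 + (k * a + b)) = 1

theorem solve_spec (h : Encodes m G col W) (hirr : ∀ v, ¬ G v v) :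
    (solve n k m 0 = 0 ∧ ¬ ∃ D, Sol G col W D) ∨
      (solve n k m 0 = 1 ∧ Sol G col W (foundDecoder n k m)) := by
  set m₁ := propagate n k (start n k m) with hm₁
  have h₁ : Encodes m₁ G col W := h.congr fun i hi => by
    rw [hm₁, propagate_of_lt _ hi, (start_spec n k m).1 i hi]
  obtain ⟨h2, h3⟩ := decode_spec h₁
  have h₂ : Encodes (decode n k m₁) G col W := h₁.congr fun i hi => h2 i (by
    unfold base'
    omega)
  obtain ⟨h4, h5⟩ := output_spec n k (decode n k m₁)
  have h6 : solve n k m = output n k (decode n k m₁) := rfl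
  have h7 : foundDecoder n k m = fun a b : Fin k => mDec (decode n k m₁) n k a b := by
    ext a b
    rw [foundDecoder, h6, h5 _ (index_lt a b), mDec]
  rw [h6, h7, h4, ← h₂.check hirr]
  by_cases hc : mCheck (decode n k m₁) n k
  · exact .inr ⟨ind_pos hc, hc⟩
  · refine .inl ⟨ind_neg hc, ?_⟩
    rintro ⟨D, hD⟩
    apply hc
    rw [h₂.check hirr]
    have := hD.choice (consistent_signChoice h hD) (signChoice_self n m₁)
    rwa [← show (fun a b : Fin k => mDec (decode n k m₁) n k a b) =
      choiceDecoder G col (signChoice n m₁) from by ext a b; exact h3 a b] at this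

end Solve

/-! ### Instances -/

theorem isSolution_iff {k : ℕ} (w : List (Fin k)) (G : SimpleGraph (Fin w.length))
    (col : Fin w.length → Fin k) (D : Set (Fin k × Fin k)) :
    IsLetterGraphRespecting G col w D ↔ Sol G.Adj col w.get fun a b => (a, b) ∈ D := by
  constructor
  · rintro ⟨f, hf⟩
    exact ⟨f.toEquiv, hf, fun u v => f.map_rel_iff.symm⟩
  · rintro ⟨f, hf, hG⟩
    exact ⟨⟨f, fun {u v} => (hG u v).symm⟩, hf⟩

theorem encode_getD (I : Input) : I.encode.getD 0 0 = I.n ∧ I.encode.getD 1 0 = I.k := by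
  simp [Input.encode]

open Classical in
theorem encodes_encode {k : ℕ} (w : List (Fin k)) (G : SimpleGraph (Fin w.length))
    (col : Fin w.length → Fin k) :
    Encodes (fun i => (Input.encode ⟨w.length, k, G, col, w, rfl⟩).getD i 0) G.Adj col w.get := by
  refine ⟨fun u v => ?_, fun v => ?_, fun p => ?_⟩
  · have hlt : w.length * u + v < w.length * w.length := index_lt u v
    have hu : Fin.divNat (⟨w.length * u + v, hlt⟩ : Fin (w.length * w.length)) = u := by
      ext
      simp [Fin.divNat, Nat.mul_add_div (Nat.zero_lt_of_lt v.2), Nat.div_eq_of_lt v.2]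
    have hv : Fin.modNat (⟨w.length * u + v, hlt⟩ : Fin (w.length * w.length)) = v := by
      ext
      simp [Fin.modNat, Nat.mod_eq_of_lt v.2]
    simp only [mAdj, Input.encode]
    rw [List.getD_append_right _ _ _ _ (by simp; omega), List.getD_eq_getElem _ _ (by simp; omega)]
    rw [List.getElem_ofFn]
    have : ∀ i, i = w.length * u + v → ∀ hi, (⟨i, hi⟩ : Fin (w.length * w.length)) =
      ⟨w.length * u + v, hlt⟩ := by rintro _ rfl _; rfl
    rw [this _ (by simp; omega), hu, hv]
    simp
  · simp only [mCol, Input.encode]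
    have := v.2
    rw [List.getD_append _ _ _ _ (by simp; omega), List.getD_append _ _ _ _ (by simp; omega),
      List.getD_append_right _ _ _ _ (by simp), List.getD_eq_getElem _ _ (by simp)]
    simp
  · have hword : (Input.encode ⟨w.length, k, G, col, w, rfl⟩) =
        [w.length, k] ++ List.ofFn (fun v => (col v : ℕ)) ++ List.map (fun a : Fin k => (a : ℕ)) w ++
          List.ofFn (fun i : Fin (w.length * w.length) =>
            if G.Adj i.divNat i.modNat then 1 else 0) := by
      simp [Input.encode, List.map_eq_flatMap]
    have := p.2
    have e : ∀ i (hi : i < w.length), i = p → (w[i] : ℕ) = w.get p := by rintro _ _ rfl; rfl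
    rw [mWord, hword, List.getD_append _ _ _ _ (by simp; omega),
      List.getD_append_right _ _ _ _ (by simp; omega), List.getD_eq_getElem _ _ (by simp; omega),
      List.getElem_map]
    refine e _ _ ?_
    simp only [List.length_append, List.length_cons, List.length_nil, List.length_ofFn]
    omega

end DecoderRetrieval

/-- Decoder Retrieval is solvable in time polynomial in `|V| + |Σ|`. -/
theorem mainTheorem2 :
    ∃ (P : RAM.Program) (p : Polynomial ℕ), ∀ I : DecoderRetrieval.Input,
      ∃ (t : ℕ) (m : ℕ → ℕ),
        t ≤ p.eval (I.n + I.k) ∧ RAM.HaltsWithin P I.encode t m ∧ I.CorrectAnswer m := by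
  open DecoderRetrieval in
  obtain ⟨P, p, h⟩ := RAM.CompS.haltsWithin compS_solve
  refine ⟨P, p, fun I => ?_⟩
  obtain ⟨t, ht, hP⟩ := h I.encode
  rw [(encode_getD I).1, (encode_getD I).2] at ht hP
  refine ⟨t, _, ht, hP, ?_⟩
  -- Substituting the length equation makes the vertices and the positions of the word the same
  -- type.
  obtain ⟨n, k, G, col, w, rfl⟩ := I
  have hs := solve_spec (encodes_encode w G col) fun v => G.loopless.irrefl v
  unfold Input.CorrectAnswer Input.IsSolution
  simp only [isSolution_iff]
  rcases hs with ⟨h0, hD⟩ | ⟨h1, hD⟩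
  · exact .inl ⟨h0, fun ⟨D, h⟩ => hD ⟨_, h⟩⟩
  · refine .inr ⟨h1, ?_⟩
    convert hD using 1
    ext a b
    simp only [readDecoder, Set.mem_ofPred_eq, foundDecoder, mul_comm (a : ℕ) k]
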